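/- Let $H$ be the honeycomb graph, drawn with horizontal edges, whose hexagons are labelled by $\mathbb Z^3/\mathbb Z(1,1,1)$ (the projection of $\mathbb Z^3$ to the plane normal to $(1,1,1)$), and let $2H$ be the honeycomb graph obtained in the same way from $(2\mathbb Z)^3$. The edges of $H$ that lie on no hexagon with even coordinates form disjoint claws (propellers: a vertex with its three neighbours); contracting each propeller to a point turns $H$ into $2H$, and exactly two edges of even hexagons are sent to each edge of $2H$. The squish map $\mathrm{Sq}$ sends a dimer configuration (perfect matching) $m$ to the double dimer configuration (every vertex has degree $2$, doubled edges allowed) in which the multiplicity of an edge $e$ of $2H$ is the number of edges of $m$ sent to $e$. It maps dimer configurations of $H$ to double dimer configurations of $2H$, and those of the $2x\times2y\times2z$ honeycomb graph $H_{2x,2y,2z}$ to those of $H_{x,y,z}$. For $a,b,c\in\mathbb C^*$ put $A=\mathrm{diag}(a,a^{-1})$, $B=\mathrm{diag}(b^{-1},b)$, $C=\mathrm{diag}(c,c^{-1})$, $J=\mathrm{diag}(1,-1)$, $L=\begin{bmatrix}0&1\\1&1\end{bmatrix}$, $R=\begin{bmatrix}1&1\\1&0\end{bmatrix}$ and $$\alpha=iAJ,\qquad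 \beta=iRBLJ,\qquad \gamma=-iLCRJ\qquad(\text{elements of } \mathrm{SL}_2(\mathbb C)).$$ The connection on $2H$ assigns $\alpha,\beta,\gamma$ to steps in the directions NE, NW, W, and the inverse matrices to the opposite steps. The contribution $\mathrm{Tr}(\ell)$ of a closed loop $\ell$ is the trace of the product of these matrices along $\ell$ (later steps to the left), for any base point and either direction. Theorem. Let $a=b=c=\omega$ be a primitive $n$th root of unity with $n=1$ or $n=2$, i.e. $\omega=\pm1$. Let $D$ be a double dimer configuration of $2H$, or of $H_{x,y,z}$ for some $x,y,z\ge0$. 1. For every loop $\ell$ of $D$ (a component of $D$ that is a cycle, not a doubled edge), $\mathrm{Tr}(\ell)$ is the number of dimer configurations that squish to $\ell$, that is, of perfect matchings $m$ of the subgraph of $H$ induced on the propellers that are contracted to the vertices of $\ell$ with $\mathrm{Sq}(m)=\ell$. Moreover $\mathrm{Tr}(\ell)$ is the trace of the product of the turn matrices along $\ell$, with $L$ for each left turn and $R$ for each right turn. 2. If $D$ has finitely many loops $\ell_1,\dots,\ell_k$, then $\prod_{j=1}^k\mathrm{Tr}(\ell_j)$ is the number of dimer configurations $m$ (of $H$,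 respectively of $H_{2x,2y,2z}$) with $\mathrm{Sq}(m)=D$. In particular, if $\ell$ is the only loop of $D$, this number is $\mathrm{Tr}(\ell)$. -/

import Mathlib

open SimpleGraph Matrix

namespace Squish

/-! ### The honeycomb graph

The hexagon labelled by `(i, j, k) ∈ ℤ³` (modulo `(1, 1, 1)`) is represented by the lattice point
`(i - k, j - k) ∈ ℤ²`.  In the plane normal to `(1, 1, 1)`, the projections of the unit vectors
`e₁`, `e₂`, `e₃` point in the directions `210°`, `330°`, `90°`, so hexagons have horizontal top and
bottom edges.  A vertex of the honeycomb graph is a triple of mutually adjacent hexagons, i.e. a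
unit triangle of the triangular lattice. -/

/-- `(x, y, false)` is the triangle `{p, p + e₁, p + e₁ + e₂}` and `(x, y, true)` is the triangle
`{p, p + e₂, p + e₁ + e₂}`, with `p = (x, y)`.  The Boolean is the bipartite colour. -/
abbrev Vertex : Type := ℤ × ℤ × Bool

/-- The three hexagons that meet at a vertex. -/
def corners : Vertex → Finset (ℤ × ℤ)
  | (x, y, false) => {(x, y), (x + 1, y), (x + 1, y + 1)}
  | (x, y, true) => {(x, y), (x, y + 1), (x + 1, y + 1)}

/-- The three neighbours of a vertex: across the horizontal edge, across the edge of slope NW/SE,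
and across the edge of slope NE/SW, in this order. -/
def nbr : Vertex → Fin 3 → Vertex
  | (x, y, false) => ![(x, y, true), (x, y - 1, true), (x + 1, y, true)]
  | (x, y, true) => ![(x, y, false), (x, y + 1, false), (x - 1, y, false)]

/-- The honeycomb graph. -/
def honeycomb : SimpleGraph Vertex where
  Adj v w := ∃ j, w = nbr v j
  symm := ⟨by
    rintro ⟨x, y, b⟩ w ⟨j, rfl⟩
    refine ⟨j, ?_⟩
    cases b <;> fin_cases j <;> simp [nbr]⟩
  loopless := ⟨by
    rintro ⟨x, y, b⟩ ⟨j, hj⟩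
    cases b <;> fin_cases j <;> simp [nbr] at hj⟩

/-- The direction of the step from `v` to an adjacent vertex `w`; the value `k` stands for the
angle `60 k` degrees, so `0, 1, 2, 3, 4, 5` are E, NE, NW, W, SW, SE. -/
def heading (v w : Vertex) : Fin 6 :=
  match v.2.2 with
  | false => if w = nbr v 0 then 0 else if w = nbr v 1 then 2 else 4
  | true => if w = nbr v 0 then 3 else if w = nbr v 1 then 5 else 1

/-- The vertex set of the `x × y × z` honeycomb graph `H_{x,y,z}`: the triangles all of whose
corners are projections of lattice points of the box `[0, x] × [0, y] × [0, z]`. -/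
def box (x y z : ℕ) : Set Vertex :=
  {v | ∀ p ∈ corners v, ∃ k : ℤ, (0 ≤ k ∧ k ≤ z) ∧ (0 ≤ p.1 + k ∧ p.1 + k ≤ x) ∧
    (0 ≤ p.2 + k ∧ p.2 + k ≤ y)}

/-! ### Single and double dimer configurations -/

/-- `M` is a dimer configuration (perfect matching) of the subgraph of the honeycomb graph induced
on `S`. -/
def IsDimer (S : Set Vertex) (M : honeycomb.Subgraph) : Prop :=
  M.verts = S ∧ M.IsMatching

/-- `D` is a double dimer configuration of the subgraph of the honeycomb graph induced on `S`:
it gives the multiplicity of every edge, and every vertex of `S` has degree two. -/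
def IsDoubleDimer (S : Set Vertex) (D : Sym2 Vertex → ℕ) : Prop :=
  (∀ e, D e ≠ 0 → e ∈ honeycomb.edgeSet ∧ ∀ v ∈ e, v ∈ S) ∧
    ∀ v ∈ S, ∑ j, D s(v, nbr v j) = 2

/-- `L` runs once around a closed loop of the double dimer configuration `D` (from some base point
and in some direction). -/
def IsLoopOf (D : Sym2 Vertex → ℕ) {v : Vertex} (L : honeycomb.Walk v v) : Prop :=
  L.IsCycle ∧ ∀ e ∈ L.edges, D e = 1

/-! ### The squish map -/

/-- `e` is an edge of an even hexagon. Here `e` is meant to be an edge of the honeycomb graph. -/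
def IsEvenEdge (e : Sym2 Vertex) : Prop :=
  ∃ p : ℤ × ℤ, Even p.1 ∧ Even p.2 ∧ ∀ v ∈ e, p ∈ corners v

/-- Every vertex of `H` lies in exactly one propeller: a central vertex, which has no even corner,
with its three neighbours.  Its four triangles form a triangle of side two with even corners, i.e.
a vertex of the double-sized honeycomb `2H`, to which the propeller is contracted.  Vertices of
`2H` are named by the coordinates of their corners divided by two. -/
def squishVertex : Vertex → Vertex
  | (x, y, false) => (x / 2, y / 2, decide (Even x ∧ Odd y))
  | (x, y, true) => (x / 2, y / 2, !decide (Odd x ∧ Even y))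

/-- The squish map: discard the propeller edges of `M`; every edge of `2H` then gets as its
multiplicity the number of edges of `M` that are sent to it. -/
noncomputable def squish (M : honeycomb.Subgraph) (e : Sym2 Vertex) : ℕ :=
  {e' : Sym2 Vertex | e' ∈ M.edgeSet ∧ IsEvenEdge e' ∧ Sym2.map squishVertex e' = e}.ncard

open Classical in
/-- The dimer configurations that squish to the loop `L` of `2H`: those of the subgraph of `H` on
the propellers that are contracted to the vertices of `L`, and whose image is exactly `L`. -/
noncomputable def configsOver {v : Vertex} (L : honeycomb.Walk v v) : Set honeycomb.Subgraph :=
  {M | IsDimer {u | squishVertex u ∈ L.support} M ∧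
    squish M = fun e => if e ∈ L.edges then 1 else 0}

/-- The squish map sends dimer configurations on the first region to double dimer configurations
on the second: from `H` to `2H`, and from `H_{2x,2y,2z}` to `H_{x,y,z}`. -/
inductive SquishRegions : Set Vertex → Set Vertex → Prop
  | plane : SquishRegions Set.univ Set.univ
  | box (x y z : ℕ) : SquishRegions (box (2 * x) (2 * y) (2 * z)) (box x y z)

/-! ### The connection -/

/-- The left turn matrix. -/
def turnL : Matrix (Fin 2) (Fin 2) ℂ := !![0, 1; 1, 1]

/-- The right turn matrix. -/
def turnR : Matrix (Fin 2) (Fin 2) ℂ := !![1, 1; 1, 0]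

/-- The matrix `J`. -/
def matJ : Matrix (Fin 2) (Fin 2) ℂ := !![1, 0; 0, -1]

/-- The edge matrix `A`. -/
noncomputable def matA (a : ℂˣ) : Matrix (Fin 2) (Fin 2) ℂ := !![(a : ℂ), 0; 0, (a : ℂ)⁻¹]

/-- The edge matrix `B`. -/
noncomputable def matB (b : ℂˣ) : Matrix (Fin 2) (Fin 2) ℂ := !![(b : ℂ)⁻¹, 0; 0, (b : ℂ)]

/-- The edge matrix `C`. -/
noncomputable def matC (c : ℂˣ) : Matrix (Fin 2) (Fin 2) ℂ := !![(c : ℂ), 0; 0, (c : ℂ)⁻¹]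

/-- `α = i A J`. -/
noncomputable def alpha (a : ℂˣ) : SpecialLinearGroup (Fin 2) ℂ :=
  ⟨Complex.I • (matA a * matJ), by
    have := Complex.I_mul_I
    have ha := a.ne_zero
    simp [det_fin_two, matA, matJ]
    grind⟩

/-- `β = i R B L J`. -/
noncomputable def beta (b : ℂˣ) : SpecialLinearGroup (Fin 2) ℂ :=
  ⟨Complex.I • (turnR * matB b * turnL * matJ), by
    have := Complex.I_mul_I
    have hb := b.ne_zero
    simp [det_fin_two, matB, matJ, turnL, turnR]
    grind⟩

/-- `γ = -i L C R J`. -/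
noncomputable def gamma (c : ℂˣ) : SpecialLinearGroup (Fin 2) ℂ :=
  ⟨(-Complex.I) • (turnL * matC c * turnR * matJ), by
    have := Complex.I_mul_I
    have hc := c.ne_zero
    simp [det_fin_two, matC, matJ, turnL, turnR]
    grind⟩

/-- The connection: steps in the directions NE, NW, W carry `α`, `β`, `γ`, and steps in the
opposite directions carry the inverse matrices.  Counterclockwise around a hexagon, from its lower
right edge, one reads `α, β, γ, α⁻¹, β⁻¹, γ⁻¹`. -/
noncomputable def connection (a b c : ℂˣ) (v w : Vertex) : SpecialLinearGroup (Fin 2) ℂ :=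
  ![(gamma c)⁻¹, alpha a, beta b, gamma c, (alpha a)⁻¹, (beta b)⁻¹] (heading v w)

/-- The monodromy around `L`; the matrix of a later step stands to the left of that of an earlier
one. -/
noncomputable def monodromy (a b c : ℂˣ) {v : Vertex} (L : honeycomb.Walk v v) :
    SpecialLinearGroup (Fin 2) ℂ :=
  (L.darts.map fun d => connection a b c d.fst d.snd).reverse.prod

/-- The trace contribution of the loop `L`. -/
noncomputable def contribution (a b c : ℂˣ) {v : Vertex} (L : honeycomb.Walk v v) : ℂ :=
  (monodromy a b c L : Matrix (Fin 2) (Fin 2) ℂ).trace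

/-- The matrix of the turn from heading `h` to heading `h'`, a left turn being one by `+60°`. -/
def turn (h h' : Fin 6) : Matrix (Fin 2) (Fin 2) ℂ := if h' = h + 1 then turnL else turnR

/-- The directions of the successive steps of `L`. -/
def headings {v : Vertex} (L : honeycomb.Walk v v) : List (Fin 6) :=
  L.darts.map fun d => heading d.fst d.snd

/-- The product of the turn matrices at the successive vertices of `L`, the last one being the turn
from the last step to the first; later turns stand to the left of earlier ones. -/
def turnProduct {v : Vertex} (L : honeycomb.Walk v v) : Matrix (Fin 2) (Fin 2) ℂ :=
  (List.zipWith turn (headings L) ((headings L).rotate 1)).reverse.prod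

end Squish

/-! Preimages under the squish map are counted by local choices. A propeller is a centre with three
legs, one near each hexagon at the contracted vertex, and the two even edges over an edge `e` of 2H
belong to the two hexagons beside `e`. In a dimer configuration the centre is matched to one leg and
the other two legs are matched outwards. So a preimage of `D` contains both edges over a doubled
edge, none over an edge of multiplicity zero, and exactly one over an edge of multiplicity one,
which amounts to choosing a hexagon beside that edge. Two edges meeting at a vertex must choose
different hexagons, or they would occupy the same leg. Conversely each such choice (`IsChoice`)
comes from exactly one preimage (`ncard_squish_eq`).

Consecutive edges of a loop share just one hexagon, the one on the side to which the loop turns.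
With the states left and right, the only forbidden pair is left-left at a left turn and right-right
at a right turn. The transfer matrices are therefore `turnL` and `turnR`, and the number of choices
along a loop is the trace of their cyclic product (`IsCyclic.card_isChoice`). Loops of `D` have no
common vertex, so choices on different loops are independent (`card_isChoice_iUnion`).

For ω = ±1 each connection matrix is ω times a product of two factors such that the inner factors of
consecutive steps combine to `turnL` at a left turn and to `-turnR` at a right turn. By cyclicity of
the trace the contribution of a loop is the trace of its turn product, up to ω to the length and a
sign for each right turn. The length is even because the graph is bipartite. The number of right
turns is even by a height function (`IsCyclic.prod_turn_sign`): the hexagon on the left of the loop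
changes only at right turns, where its height changes by ±2 modulo 4. Heights are defined on the
whole plane, so a configuration on a box is first extended by the doubled empty room
(`exists_extension`). -/

namespace Squish

/-! ### Local structure of the honeycomb graph -/

/-- The hexagon at `v` that is not incident with the `k`-th edge at `v`. -/
def corner : Vertex → Fin 3 → ℤ × ℤ
  | (x, y, false) => ![(x + 1, y), (x + 1, y + 1), (x, y)]
  | (x, y, true) => ![(x, y + 1), (x, y), (x + 1, y + 1)]

lemma mem_corners_iff (v : Vertex) (p : ℤ × ℤ) : p ∈ corners v ↔ ∃ k, p = corner v k := by
  obtain ⟨x, y, _ | _⟩ := v <;> simp [corners, corner, Fin.exists_fin_succ] <;> tauto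

lemma corner_injective (v : Vertex) : Function.Injective (corner v) := by
  obtain ⟨x, y, _ | _⟩ := v <;> intro k l h <;> fin_cases k <;> fin_cases l <;>
    simp [corner] at h ⊢

lemma nbr_injective (v : Vertex) : Function.Injective (nbr v) := by
  obtain ⟨x, y, _ | _⟩ := v <;> intro k l h <;> fin_cases k <;> fin_cases l <;>
    simp [nbr] at h ⊢ <;> omega

@[simp] lemma nbr_nbr (v : Vertex) (j : Fin 3) : nbr (nbr v j) j = v := by
  obtain ⟨x, y, _ | _⟩ := v <;> fin_cases j <;> simp [nbr]

lemma nbr_color (v : Vertex) (j : Fin 3) : (nbr v j).2.2 = !v.2.2 := by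
  obtain ⟨x, y, _ | _⟩ := v <;> fin_cases j <;> simp [nbr]

lemma nbr_ne (v : Vertex) (j : Fin 3) : nbr v j ≠ v := by
  intro h
  have := nbr_color v j
  simp [h] at this

/-- In `Fin 3`, `-j - k` is the third index when `k ≠ j`. The two hexagons beside an edge of
direction `j` exchange their labels when seen from its other end. -/
lemma corner_nbr (v : Vertex) {j k : Fin 3} (h : k ≠ j) :
    corner (nbr v j) (-j - k) = corner v k := by
  obtain ⟨x, y, _ | _⟩ := v <;> fin_cases j <;> fin_cases k <;>
    first | exact absurd rfl h | (simp [corner, nbr] <;> rfl)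

lemma third_ne {j k : Fin 3} (h : k ≠ j) : -j - k ≠ j := by
  revert j k; decide

lemma third_third (j k : Fin 3) : -j - (-j - k) = k := by
  revert j k; decide

lemma adj_iff (v w : Vertex) : honeycomb.Adj v w ↔ ∃ j, w = nbr v j := Iff.rfl

lemma adj_nbr (v : Vertex) (j : Fin 3) : honeycomb.Adj v (nbr v j) := ⟨j, rfl⟩

lemma edge_eq_iff (v w : Vertex) (j k : Fin 3) :
    s(w, nbr w k) = s(v, nbr v j) ↔ k = j ∧ (w = v ∨ w = nbr v j) := by
  constructor
  · intro h
    rcases Sym2.eq_iff.1 h with ⟨rfl, h2⟩ | ⟨rfl, h2⟩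
    · exact ⟨nbr_injective _ h2, Or.inl rfl⟩
    · refine ⟨?_, Or.inr rfl⟩
      have : nbr (nbr v j) k = nbr (nbr v j) j := by rw [h2, nbr_nbr]
      exact nbr_injective _ this
  · rintro ⟨rfl, rfl | rfl⟩
    · rfl
    · rw [nbr_nbr, Sym2.eq_swap]

lemma exists_eq_edge {e : Sym2 Vertex} (he : e ∈ honeycomb.edgeSet) :
    ∃ v j, e = s(v, nbr v j) := by
  induction e with
  | h v w =>
    obtain ⟨j, hj⟩ := (mem_edgeSet _).1 he
    exact ⟨v, j, by rw [hj]⟩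

lemma edge_eq_of_mem {e : Sym2 Vertex} (he : e ∈ honeycomb.edgeSet) {v : Vertex} (hv : v ∈ e) :
    ∃ j, e = s(v, nbr v j) := by
  obtain ⟨w, j, rfl⟩ := exists_eq_edge he
  rcases Sym2.mem_iff.1 hv with rfl | rfl
  · exact ⟨j, rfl⟩
  · exact ⟨j, by rw [nbr_nbr, Sym2.eq_swap]⟩

/-! ### Propellers -/

/-- The centre of the propeller that is contracted to `v`. -/
def center : Vertex → Vertex
  | (x, y, false) => (2 * x + 1, 2 * y, true)
  | (x, y, true) => (2 * x, 2 * y + 1, false)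

/-- The outer vertex, next to the `k`-th corner, of the propeller that is contracted to `v`. -/
def leg (v : Vertex) (k : Fin 3) : Vertex := nbr (center v) k

lemma nbr_leg_self (v : Vertex) (k : Fin 3) : nbr (leg v k) k = center v := nbr_nbr _ _

/-- The two values `k ≠ j` give the two edges over the `j`-th edge at `v`. Legs are relabelled
exactly as hexagons are in `corner_nbr`, so a choice of hexagon means the same from both ends. -/
lemma nbr_leg (v : Vertex) {j k : Fin 3} (h : k ≠ j) :
    nbr (leg v k) j = leg (nbr v j) (-j - k) := by
  obtain ⟨x, y, _ | _⟩ := v <;> fin_cases j <;> fin_cases k <;>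
    first
    | exact absurd rfl h
    | (simp [leg, center, nbr]; try ring_nf; try rfl)

/-- The parities of the coordinates and the colour give eight classes: two consist of centres, and
the other six of the legs of each index and colour. -/
lemma center_or_leg (u : Vertex) :
    u = center (squishVertex u) ∨ ∃ k, u = leg (squishVertex u) k := by
  obtain ⟨x, y, b⟩ := u
  have h (a : ℤ) : (2 * a + 1) / 2 = a := by omega
  have h' (a : ℤ) : ¬ Odd (2 * a) := by simp
  rcases Int.even_or_odd' x with ⟨a, rfl | rfl⟩ <;>
    rcases Int.even_or_odd' y with ⟨c, rfl | rfl⟩ <;>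
    cases b <;> simp [squishVertex, center, leg, nbr, Fin.exists_fin_succ, parity_simps, h, h']

lemma squishVertex_center (v : Vertex) : squishVertex (center v) = v := by
  obtain ⟨x, y, _ | _⟩ := v <;> simp [squishVertex, center, parity_simps] <;> omega

lemma squishVertex_leg (v : Vertex) (k : Fin 3) : squishVertex (leg v k) = v := by
  obtain ⟨x, y, _ | _⟩ := v <;> fin_cases k <;>
    simp [squishVertex, center, leg, nbr, parity_simps] <;> omega

lemma leg_injective (v : Vertex) : Function.Injective (leg v) := nbr_injective _

lemma leg_ne_center (v w : Vertex) (k : Fin 3) : leg v k ≠ center w := by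
  intro h
  have h1 := squishVertex_leg v k
  rw [h, squishVertex_center] at h1
  subst h1
  exact nbr_ne _ _ h

lemma leg_eq_iff (v w : Vertex) (k l : Fin 3) : leg v k = leg w l ↔ v = w ∧ k = l := by
  constructor
  · intro h
    have h1 := squishVertex_leg v k
    rw [h, squishVertex_leg] at h1
    subst h1
    exact ⟨rfl, leg_injective _ h⟩
  · rintro ⟨rfl, rfl⟩; rfl

lemma center_eq_iff (v w : Vertex) : center v = center w ↔ v = w := by
  constructor
  · intro h
    rw [← squishVertex_center v, h, squishVertex_center]
  · rintro rfl; rfl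

lemma isEvenEdge_leg (v : Vertex) {j k : Fin 3} (h : k ≠ j) :
    IsEvenEdge s(leg v k, nbr (leg v k) j) := by
  refine ⟨(2 * (corner v k).1, 2 * (corner v k).2), by simp, by simp, ?_⟩
  obtain ⟨x, y, _ | _⟩ := v <;> fin_cases j <;> fin_cases k <;>
    first
    | exact absurd rfl h
    | (simp [leg, center, nbr, corners, corner]; try omega)

lemma not_isEvenEdge_center (v : Vertex) (w : Vertex) :
    ¬ IsEvenEdge s(center v, w) := by
  rintro ⟨⟨p, q⟩, hp, hq, h⟩
  have := h (center v) (by simp)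
  simp only [Int.even_iff] at hp hq
  obtain ⟨x, y, _ | _⟩ := v <;> simp [center, corners] at this <;> omega

/-! ### Dimer configurations with a given image under the squish map -/

lemma corner_not_mem_nbr (v : Vertex) (j : Fin 3) : corner v j ∉ corners (nbr v j) := by
  obtain ⟨x, y, _ | _⟩ := v <;> fin_cases j <;> simp [corner, corners, nbr]

lemma edge_symm (v : Vertex) (j : Fin 3) :
    s(nbr v j, nbr (nbr v j) j) = s(v, nbr v j) := by
  rw [nbr_nbr, Sym2.eq_swap]

lemma exists_leg_of_isEvenEdge {e : Sym2 Vertex} (he : e ∈ honeycomb.edgeSet)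
    (h : IsEvenEdge e) : ∃ v j k, k ≠ j ∧ e = s(leg v k, nbr (leg v k) j) := by
  obtain ⟨u, j, rfl⟩ := exists_eq_edge he
  rcases center_or_leg u with hu | ⟨k, hu⟩
  · rw [hu] at h
    exact absurd h (not_isEvenEdge_center _ _)
  · rw [hu] at h ⊢
    refine ⟨_, j, k, ?_, rfl⟩
    rintro rfl
    rw [nbr_leg_self, Sym2.eq_swap] at h
    exact not_isEvenEdge_center _ _ h

lemma map_squishVertex_leg (v : Vertex) {j k : Fin 3} (h : k ≠ j) :
    Sym2.map squishVertex s(leg v k, nbr (leg v k) j) = s(v, nbr v j) := by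
  rw [nbr_leg v h, Sym2.map_mk, squishVertex_leg, squishVertex_leg]

lemma squish_ne_zero {M : honeycomb.Subgraph} {e : Sym2 Vertex} (h : squish M e ≠ 0) :
    e ∈ honeycomb.edgeSet := by
  obtain ⟨e', h1, h2, rfl⟩ := Set.nonempty_of_ncard_ne_zero h
  obtain ⟨v, j, k, hk, rfl⟩ := exists_leg_of_isEvenEdge (M.edgeSet_subset h1) h2
  rw [map_squishVertex_leg v hk]
  exact adj_nbr v j

open Classical in
lemma squish_edge (M : honeycomb.Subgraph) (v : Vertex) (j : Fin 3) :
    squish M s(v, nbr v j) =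
      (Finset.univ.filter fun k => k ≠ j ∧ M.Adj (leg v k) (nbr (leg v k) j)).card := by
  have : {e' : Sym2 Vertex | e' ∈ M.edgeSet ∧ IsEvenEdge e' ∧
      Sym2.map squishVertex e' = s(v, nbr v j)} =
      (fun k => s(leg v k, nbr (leg v k) j)) ''
        (Finset.univ.filter fun k => k ≠ j ∧ M.Adj (leg v k) (nbr (leg v k) j) : Finset _) := by
    ext e'
    simp only [Set.mem_ofPred_eq, Set.mem_image, Finset.coe_filter, Finset.mem_univ, true_and]
    constructor
    · rintro ⟨h1, h2, h3⟩
      obtain ⟨w, i, k, hk, rfl⟩ := exists_leg_of_isEvenEdge (M.edgeSet_subset h1) h2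
      rw [map_squishVertex_leg w hk] at h3
      obtain ⟨rfl, rfl | rfl⟩ := (edge_eq_iff v w j i).1 h3
      · exact ⟨k, ⟨hk, h1⟩, rfl⟩
      -- The edge was described from its other end, so the leg label is exchanged.
      · have h4 := third_ne hk
        have h5 : leg v (-i - k) = nbr (leg (nbr v i) k) i := by
          rw [nbr_leg (nbr v i) hk, nbr_nbr]
        refine ⟨-i - k, ⟨h4, ?_⟩, ?_⟩
        · rw [h5, nbr_nbr]; exact h1.symm
        · rw [h5, nbr_nbr, Sym2.eq_swap]
    · rintro ⟨k, ⟨hk, h1⟩, rfl⟩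
      exact ⟨h1, isEvenEdge_leg v hk, map_squishVertex_leg v hk⟩
  rw [squish, this, Set.InjOn.ncard_image, Set.ncard_coe_finset]
  intro k _ l hl h
  obtain ⟨-, h | h⟩ := (edge_eq_iff _ _ _ _).1 h
  · exact leg_injective v h
  · rw [Finset.mem_coe, Finset.mem_filter] at hl
    rw [nbr_leg v hl.2.1, leg_eq_iff] at h
    exact absurd h.1.symm (nbr_ne v j)

/-- A choice of an incident hexagon for every edge in `E`, such that edges with a common vertex
choose different hexagons. -/
def IsChoice (E : Set (Sym2 Vertex)) (s : E → ℤ × ℤ) : Prop :=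
  (∀ e : E, ∀ v ∈ e.1, s e ∈ corners v) ∧
    ∀ e f : E, e ≠ f → ∀ v, v ∈ e.1 → v ∈ f.1 → s e ≠ s f

variable {S : Set Vertex} {D : Sym2 Vertex → ℕ}

/-- The edge of an even hexagon that joins the `k`-th outer vertex of the propeller at `v` to the
neighbouring propeller in direction `j` is used. -/
def Used (D : Sym2 Vertex → ℕ) (s : {e | D e = 1} → ℤ × ℤ) (v : Vertex) (j k : Fin 3) : Prop :=
  k ≠ j ∧ (D s(v, nbr v j) = 2 ∨ ∃ e : {e | D e = 1}, e.1 = s(v, nbr v j) ∧ s e = corner v k)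

lemma Used.symm {s : {e | D e = 1} → ℤ × ℤ} {v : Vertex} {j k : Fin 3} (h : Used D s v j k) :
    Used D s (nbr v j) j (-j - k) := by
  obtain ⟨hk, h⟩ := h
  refine ⟨third_ne hk, ?_⟩
  rwa [edge_symm, corner_nbr v hk]

lemma IsDoubleDimer.mem (hD : IsDoubleDimer S D) {v : Vertex} {j : Fin 3}
    (h : D s(v, nbr v j) ≠ 0) : v ∈ S :=
  (hD.1 _ h).2 _ (by simp)

lemma IsDoubleDimer.sum_eq (hD : IsDoubleDimer S D) {v : Vertex} (hv : v ∈ S) {i j : Fin 3}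
    (h : i ≠ j) : D s(v, nbr v i) + D s(v, nbr v j) + D s(v, nbr v (-i - j)) = 2 := by
  obtain ⟨h1, h2, h3⟩ := (by decide : ∀ i j : Fin 3, i ≠ j →
    (Finset.univ : Finset (Fin 3)) = {i, j, -i - j} ∧ i ≠ -i - j ∧ j ≠ -i - j) i j h
  rw [← hD.2 v hv, h1, Finset.sum_insert (by simp [h, h2]), Finset.sum_insert (by simpa using h3),
    Finset.sum_singleton, add_assoc]

lemma IsDoubleDimer.le_two (hD : IsDoubleDimer S D) (v : Vertex) (j : Fin 3) :
    D s(v, nbr v j) ≤ 2 := by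
  by_cases h : D s(v, nbr v j) = 0
  · omega
  · have := hD.sum_eq (hD.mem h) (i := j) (j := j + 1) (by simp)
    omega

lemma Used.mem (hD : IsDoubleDimer S D) {s : {e | D e = 1} → ℤ × ℤ} {v : Vertex} {j k : Fin 3}
    (h : Used D s v j k) : v ∈ S := by
  apply hD.mem (j := j)
  obtain ⟨-, h | ⟨⟨e, he⟩, rfl, -⟩⟩ := h
  · omega
  · rw [Set.mem_ofPred_eq] at he; omega

/-- A leg is matched outwards in at most one direction: two positive multiplicities at `v` must both
be one, and then both edges would choose the hexagon at leg `k`. -/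
lemma Used.unique (hD : IsDoubleDimer S D) {s : {e | D e = 1} → ℤ × ℤ}
    (hs : IsChoice {e | D e = 1} s) {v : Vertex} {i j k : Fin 3}
    (hi : Used D s v i k) (hj : Used D s v j k) : i = j := by
  by_contra h
  have h2 := hD.sum_eq (hi.mem hD) h
  obtain ⟨hi, h3 | ⟨⟨e, he⟩, rfl, h3⟩⟩ := hi <;> obtain ⟨hj, h4 | ⟨⟨f, hf⟩, rfl, h4⟩⟩ := hj <;>
    try rw [Set.mem_ofPred_eq] at he
  all_goals try rw [Set.mem_ofPred_eq] at hf
  · omega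
  · omega
  · omega
  · refine hs.2 ⟨_, he⟩ ⟨_, hf⟩ ?_ v (by simp) (by simp) (h3.trans h4.symm)
    intro h5
    exact h ((edge_eq_iff _ _ _ _).1 (congrArg Subtype.val h5)).1

lemma IsChoice.exists_corner {E : Set (Sym2 Vertex)} {s : E → ℤ × ℤ} (hs : IsChoice E s)
    (e : E) {v : Vertex} {j : Fin 3} (he : e.1 = s(v, nbr v j)) :
    ∃ k, k ≠ j ∧ s e = corner v k := by
  obtain ⟨k, hk⟩ := (mem_corners_iff _ _).1 (hs.1 e v (by simp [he]))
  refine ⟨k, ?_, hk⟩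
  rintro rfl
  have := hs.1 e (nbr v k) (by simp [he])
  rw [hk] at this
  exact corner_not_mem_nbr _ _ this

open Classical in
lemma card_used (hD : IsDoubleDimer S D) {s : {e | D e = 1} → ℤ × ℤ}
    (hs : IsChoice {e | D e = 1} s) (v : Vertex) (j : Fin 3) :
    (Finset.univ.filter fun k => Used D s v j k).card = D s(v, nbr v j) := by
  have h2 := hD.le_two v j
  generalize hm : D s(v, nbr v j) = m at h2
  interval_cases m
  · rw [Finset.card_eq_zero, Finset.filter_eq_empty_iff]
    rintro k - ⟨-, h | ⟨⟨e, he⟩, rfl, -⟩⟩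
    · omega
    · rw [Set.mem_ofPred_eq] at he; omega
  · rw [Finset.card_eq_one]
    obtain ⟨k, hk, h⟩ := hs.exists_corner ⟨s(v, nbr v j), hm⟩ rfl
    refine ⟨k, ?_⟩
    ext l
    simp only [Finset.mem_filter, Finset.mem_univ, true_and, Finset.mem_singleton]
    constructor
    · rintro ⟨-, h' | ⟨⟨e, he⟩, rfl, h'⟩⟩
      · omega
      · rw [h] at h'
        exact (corner_injective v h').symm
    · rintro rfl
      exact ⟨hk, Or.inr ⟨_, rfl, h⟩⟩
  · have : (Finset.univ.filter fun k => Used D s v j k) = Finset.univ.filter (· ≠ j) := by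
      ext k
      simp [Used, hm]
    rw [this, Finset.filter_ne', Finset.card_erase_of_mem (Finset.mem_univ _)]
    rfl

/-- The legs used by the three directions are disjoint sets of total size two, the degree of `v`.
The remaining leg is the one matched to the centre. -/
lemma existsUnique_unused (hD : IsDoubleDimer S D) {s : {e | D e = 1} → ℤ × ℤ}
    (hs : IsChoice {e | D e = 1} s) {v : Vertex} (hv : v ∈ S) :
    ∃! k, ∀ i, ¬ Used D s v i k := by
  classical
  have h1 : (Finset.univ.biUnion fun j => Finset.univ.filter fun k => Used D s v j k).card = 2 := by
    rw [Finset.card_biUnion]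
    · simp_rw [card_used hD hs v]
      exact hD.2 v hv
    · intro i _ j _ hij
      rw [Function.onFun, Finset.disjoint_left]
      intro k hi hj
      exact hij (Used.unique hD hs (Finset.mem_filter.1 hi).2 (Finset.mem_filter.1 hj).2)
  have h2 := Finset.card_compl (Finset.univ.biUnion fun j =>
    Finset.univ.filter fun k => Used D s v j k)
  rw [h1, Fintype.card_fin, Finset.card_eq_one] at h2
  obtain ⟨k, hk⟩ := h2
  have h3 (l : Fin 3) : (∀ i, ¬ Used D s v i l) ↔ l = k := by
    rw [← Finset.mem_singleton, ← hk]
    simp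
  exact ⟨k, (h3 k).2 rfl, fun l hl => (h3 l).1 hl⟩

/-- The `j`-th edge at `u` belongs to the dimer configuration given by the choice `s`. -/
def Dimer (S : Set Vertex) (D : Sym2 Vertex → ℕ) (s : {e | D e = 1} → ℤ × ℤ) (u : Vertex)
    (j : Fin 3) : Prop :=
  (∃ v ∈ S, (u = center v ∨ u = leg v j) ∧ ∀ i, ¬ Used D s v i j) ∨
    ∃ v k, u = leg v k ∧ Used D s v j k

lemma dimer_center (s : {e | D e = 1} → ℤ × ℤ) (v : Vertex) (k : Fin 3) :
    Dimer S D s (center v) k ↔ v ∈ S ∧ ∀ i, ¬ Used D s v i k := by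
  constructor
  · rintro (⟨w, hw, h | h, h'⟩ | ⟨w, l, h, -⟩)
    · rw [(center_eq_iff _ _).1 h]; exact ⟨hw, h'⟩
    · exact absurd h.symm (leg_ne_center _ _ _)
    · exact absurd h.symm (leg_ne_center _ _ _)
  · rintro ⟨h1, h2⟩
    exact Or.inl ⟨v, h1, Or.inl rfl, h2⟩

lemma dimer_leg_self (s : {e | D e = 1} → ℤ × ℤ) (v : Vertex) (k : Fin 3) :
    Dimer S D s (leg v k) k ↔ v ∈ S ∧ ∀ i, ¬ Used D s v i k := by
  constructor
  · rintro (⟨w, hw, h | h, h'⟩ | ⟨w, l, h, h'⟩)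
    · exact absurd h (leg_ne_center _ _ _)
    · rw [((leg_eq_iff _ _ _ _).1 h).1]; exact ⟨hw, h'⟩
    · obtain ⟨rfl, rfl⟩ := (leg_eq_iff _ _ _ _).1 h
      exact absurd rfl h'.1
  · rintro ⟨h1, h2⟩
    exact Or.inl ⟨v, h1, Or.inr rfl, h2⟩

lemma dimer_leg (s : {e | D e = 1} → ℤ × ℤ) (v : Vertex) {j k : Fin 3} (hk : k ≠ j) :
    Dimer S D s (leg v k) j ↔ Used D s v j k := by
  constructor
  · rintro (⟨w, hw, h | h, h'⟩ | ⟨w, l, h, h'⟩)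
    · exact absurd h (leg_ne_center _ _ _)
    · exact absurd ((leg_eq_iff _ _ _ _).1 h).2 hk
    · obtain ⟨rfl, rfl⟩ := (leg_eq_iff _ _ _ _).1 h
      exact h'
  · exact fun h => Or.inr ⟨v, k, rfl, h⟩

lemma Dimer.symm {s : {e | D e = 1} → ℤ × ℤ} {u : Vertex} {j : Fin 3}
    (h : Dimer S D s u j) : Dimer S D s (nbr u j) j := by
  obtain ⟨v, hv, rfl | rfl, h'⟩ | ⟨v, k, rfl, h⟩ := h
  · exact (dimer_leg_self s v j).2 ⟨hv, h'⟩
  · rw [nbr_leg_self]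
    exact (dimer_center s v j).2 ⟨hv, h'⟩
  · rw [nbr_leg v h.1]
    exact (dimer_leg s _ (third_ne h.1)).2 h.symm

lemma Dimer.mem (hD : IsDoubleDimer S D) {s : {e | D e = 1} → ℤ × ℤ} {u : Vertex} {j : Fin 3}
    (h : Dimer S D s u j) : squishVertex u ∈ S := by
  obtain ⟨v, hv, rfl | rfl, -⟩ | ⟨v, k, rfl, h⟩ := h
  · rwa [squishVertex_center]
  · rwa [squishVertex_leg]
  · rw [squishVertex_leg]
    exact h.mem hD

/-- The dimer configuration given by the double dimer configuration `D` and the choice `s`. -/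
def dimerOf (hD : IsDoubleDimer S D) (s : {e | D e = 1} → ℤ × ℤ) : honeycomb.Subgraph where
  verts := squishVertex ⁻¹' S
  Adj u w := ∃ j, w = nbr u j ∧ Dimer S D s u j
  adj_sub := fun ⟨j, h, _⟩ => ⟨j, h⟩
  edge_vert := fun ⟨_, _, h⟩ => h.mem hD
  symm := ⟨by
    rintro u w ⟨j, rfl, h⟩
    exact ⟨j, (nbr_nbr _ _).symm, h.symm⟩⟩

lemma dimerOf_adj (hD : IsDoubleDimer S D) (s : {e | D e = 1} → ℤ × ℤ) (u : Vertex) (j : Fin 3) :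
    (dimerOf hD s).Adj u (nbr u j) ↔ Dimer S D s u j := by
  constructor
  · rintro ⟨k, h, h'⟩
    rwa [nbr_injective u h]
  · exact fun h => ⟨j, rfl, h⟩

lemma isDimer_dimerOf (hD : IsDoubleDimer S D) {s : {e | D e = 1} → ℤ × ℤ}
    (hs : IsChoice {e | D e = 1} s) : IsDimer (squishVertex ⁻¹' S) (dimerOf hD s) := by
  refine ⟨rfl, fun {u} (hu : squishVertex u ∈ S) => ?_⟩
  suffices h : ∃! j, Dimer S D s u j by
    obtain ⟨j, hj, hj'⟩ := h
    refine ⟨nbr u j, (dimerOf_adj hD s u j).2 hj, ?_⟩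
    rintro _ ⟨i, rfl, hi⟩
    rw [hj' i hi]
  rcases center_or_leg u with h | ⟨k, h⟩ <;> rw [h]
  · simp_rw [dimer_center, hu, true_and]
    exact existsUnique_unused hD hs hu
  · by_cases hk : ∃ i, Used D s (squishVertex u) i k
    · obtain ⟨i, hi⟩ := hk
      refine ⟨i, (dimer_leg s _ hi.1).2 hi, fun j hj => ?_⟩
      by_cases hjk : k = j
      · subst hjk
        exact absurd hi (((dimer_leg_self s _ k).1 hj).2 i)
      · exact Used.unique hD hs ((dimer_leg s _ hjk).1 hj) hi
    · push Not at hk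
      refine ⟨k, (dimer_leg_self s _ k).2 ⟨hu, hk⟩, fun j hj => ?_⟩
      by_contra hjk
      exact hk j ((dimer_leg s _ (Ne.symm hjk)).1 hj)

lemma squish_dimerOf (hD : IsDoubleDimer S D) {s : {e | D e = 1} → ℤ × ℤ}
    (hs : IsChoice {e | D e = 1} s) : squish (dimerOf hD s) = D := by
  classical
  ext e
  by_cases he : e ∈ honeycomb.edgeSet
  · obtain ⟨v, j, rfl⟩ := exists_eq_edge he
    rw [squish_edge, ← card_used hD hs v j]
    congr 1
    ext k
    simp only [Finset.mem_filter, Finset.mem_univ, true_and, dimerOf_adj]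
    constructor
    · rintro ⟨h1, h2⟩
      exact (dimer_leg s v h1).1 h2
    · exact fun h => ⟨h.1, (dimer_leg s v h.1).2 h⟩
  · rw [not_imp_comm.1 squish_ne_zero he, not_imp_comm.1 (fun h => (hD.1 e h).1) he]

lemma dimerOf_injOn (hD : IsDoubleDimer S D) {s t : {e | D e = 1} → ℤ × ℤ}
    (hs : IsChoice {e | D e = 1} s) (h : dimerOf hD s = dimerOf hD t) : s = t := by
  funext e
  obtain ⟨v, j, he⟩ := exists_eq_edge (hD.1 e.1 (by have := e.2; rw [Set.mem_ofPred_eq] at this; omega)).1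
  obtain ⟨k, hk, hk'⟩ := hs.exists_corner e he
  have h1 : Used D s v j k := ⟨hk, Or.inr ⟨e, he, hk'⟩⟩
  rw [← dimer_leg (S := S) s v hk, ← dimerOf_adj hD, h, dimerOf_adj, dimer_leg t v hk] at h1
  obtain ⟨-, h2 | ⟨f, hf, hf'⟩⟩ := h1
  · have := e.2
    rw [Set.mem_ofPred_eq, he] at this
    omega
  · rw [hk', ← hf', Subtype.ext (hf.trans he.symm)]

lemma IsDimer.unique {T : Set Vertex} {M : honeycomb.Subgraph} (hM : IsDimer T M) {u : Vertex}
    {i j : Fin 3} (hi : M.Adj u (nbr u i)) (hj : M.Adj u (nbr u j)) : i = j :=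
  nbr_injective u (hM.2.eq_of_adj_left hi hj)

/-- The choice is read off from `M`: over an edge of multiplicity one `M` has a single edge, and the
label of its leg names the hexagon. Equal hexagons at a common vertex would mean that one leg has
two partners. -/
lemma exists_choice (hD : IsDoubleDimer S D) {M : honeycomb.Subgraph} {T : Set Vertex}
    (hM : IsDimer T M) (hMD : squish M = D) :
    ∃ s : {e | D e = 1} → ℤ × ℤ, IsChoice {e | D e = 1} s ∧
      ∀ v j k, k ≠ j → (M.Adj (leg v k) (nbr (leg v k) j) ↔ Used D s v j k) := by
  classical
  -- The hexagon `p` is quantified before the description of `e`, so one `p` serves both ends.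
  have key : ∀ e : {e | D e = 1}, ∃ p, ∀ v j, e.1 = s(v, nbr v j) → ∃ k, p = corner v k ∧ k ≠ j ∧
      ∀ l, l ≠ j → (M.Adj (leg v l) (nbr (leg v l) j) ↔ l = k) := by
    rintro ⟨e, he⟩
    rw [Set.mem_ofPred_eq] at he
    obtain ⟨v, j, rfl⟩ := exists_eq_edge (hD.1 e (by omega)).1
    have h1 := squish_edge M v j
    rw [hMD, he, eq_comm, Finset.card_eq_one] at h1
    obtain ⟨k, hk⟩ := h1
    have h2 (l : Fin 3) : (l ≠ j ∧ M.Adj (leg v l) (nbr (leg v l) j)) ↔ l = k := by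
      rw [← Finset.mem_singleton, ← hk]; simp
    have hkj := ((h2 k).2 rfl).1
    refine ⟨corner v k, fun w i hw => ?_⟩
    obtain ⟨rfl, rfl | rfl⟩ := (edge_eq_iff _ _ _ _).1 hw.symm
    · exact ⟨k, rfl, hkj, fun l hl => by rw [← h2]; simp [hl]⟩
    · refine ⟨-i - k, (corner_nbr v hkj).symm, third_ne hkj, fun l hl => ?_⟩
      have h3 := h2 (-i - l)
      rw [nbr_leg v (third_ne hl), third_third] at h3
      rw [nbr_leg _ hl, nbr_nbr, M.adj_comm]
      constructor
      · intro h
        rw [← h3.1 ⟨third_ne hl, h⟩, third_third]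
      · rintro rfl
        exact (h3.2 (third_third _ _)).2
  choose s hs using key
  refine ⟨s, ⟨fun e v hv => ?_, fun e f hef v hve hvf h => ?_⟩, fun v j k hk => ?_⟩
  · obtain ⟨j, hj⟩ := edge_eq_of_mem (hD.1 e.1 (by rw [e.2]; simp)).1 hv
    obtain ⟨k, hk, -⟩ := hs e v j hj
    rw [hk, mem_corners_iff]
    exact ⟨k, rfl⟩
  · obtain ⟨i, hi⟩ := edge_eq_of_mem (hD.1 e.1 (by rw [e.2]; simp)).1 hve
    obtain ⟨j, hj⟩ := edge_eq_of_mem (hD.1 f.1 (by rw [f.2]; simp)).1 hvf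
    obtain ⟨k, hk, hki, hk'⟩ := hs e v i hi
    obtain ⟨l, hl, hlj, hl'⟩ := hs f v j hj
    rw [hk, hl] at h
    obtain rfl := corner_injective v h
    obtain rfl := hM.unique ((hk' k hki).2 rfl) ((hl' k hlj).2 rfl)
    exact hef (Subtype.ext (hi.trans hj.symm))
  · have h1 := squish_edge M v j
    have h2 := hD.le_two v j
    rw [hMD] at h1
    generalize hm : D s(v, nbr v j) = m at h1 h2
    interval_cases m
    · rw [eq_comm, Finset.card_eq_zero, Finset.filter_eq_empty_iff] at h1
      refine iff_of_false (fun h => h1 (Finset.mem_univ k) ⟨hk, h⟩) ?_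
      rintro ⟨-, h | ⟨⟨e, he⟩, rfl, -⟩⟩
      · omega
      · rw [Set.mem_ofPred_eq] at he; omega
    · obtain ⟨l, hl, -, hl'⟩ := hs ⟨_, hm⟩ v j rfl
      rw [hl' k hk]
      constructor
      · rintro rfl
        exact ⟨hk, Or.inr ⟨_, rfl, hl⟩⟩
      · rintro ⟨-, h | ⟨⟨e, he⟩, rfl, h⟩⟩
        · omega
        · rw [hl] at h
          exact (corner_injective v h).symm
    · refine iff_of_true ?_ ⟨hk, Or.inl hm⟩
      have h3 : (Finset.univ.filter fun k => k ≠ j ∧ M.Adj (leg v k) (nbr (leg v k) j)) =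
          Finset.univ.filter (· ≠ j) := by
        apply Finset.eq_of_subset_of_card_le
        · intro l; simp +contextual
        · rw [← h1, Finset.filter_ne', Finset.card_erase_of_mem (Finset.mem_univ _)]; rfl
      have h4 : k ∈ Finset.univ.filter (· ≠ j) := by simp [hk]
      rw [← h3] at h4
      exact (Finset.mem_filter.1 h4).2.2

/-- The even edges agree by assumption, and a leg without one can only be matched to its centre.
Thus one perfect matching is contained in another on the same vertices, which forces equality. -/
lemma dimerOf_eq (hD : IsDoubleDimer S D) {M : honeycomb.Subgraph}
    (hM : IsDimer (squishVertex ⁻¹' S) M) {s : {e | D e = 1} → ℤ × ℤ}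
    (hs : IsChoice {e | D e = 1} s)
    (h : ∀ v j k, k ≠ j → (M.Adj (leg v k) (nbr (leg v k) j) ↔ Used D s v j k)) :
    dimerOf hD s = M := by
  have hN := isDimer_dimerOf hD hs
  have self (v : Vertex) (k : Fin 3) (h' : Dimer S D s (leg v k) k) :
      M.Adj (leg v k) (center v) := by
    rw [dimer_leg_self] at h'
    have h1 : leg v k ∈ M.verts := by
      rw [hM.1, Set.mem_preimage, squishVertex_leg]
      exact h'.1
    obtain ⟨w, hw, -⟩ := hM.2 h1
    obtain ⟨i, rfl⟩ := (adj_iff _ _).1 hw.adj_sub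
    by_cases hk : k = i
    · subst hk
      rwa [nbr_leg_self] at hw
    · exact absurd ((h v i k hk).1 hw) (h'.2 i)
  have key : ∀ u j, Dimer S D s u j → M.Adj u (nbr u j) := by
    intro u j hj
    rcases center_or_leg u with hu | ⟨k, hu⟩
    · rw [hu] at hj ⊢
      exact (self _ j hj.symm).symm
    · rw [hu] at hj ⊢
      by_cases hk : k = j
      · subst hk
        rw [nbr_leg_self]
        exact self _ _ hj
      · exact (h _ _ _ hk).2 ((dimer_leg s _ hk).1 hj)
  apply SimpleGraph.Subgraph.ext
  · exact hM.1.symm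
  · ext u w
    constructor
    · rintro ⟨j, rfl, hj⟩
      exact key u j hj
    · intro hw
      have hu : u ∈ (dimerOf hD s).verts := by
        rw [hN.1, ← hM.1]
        exact M.edge_vert hw
      obtain ⟨_, hw', -⟩ := hN.2 hu
      obtain ⟨j, rfl, hj⟩ := id hw'
      rw [hM.2.eq_of_adj_left hw (key u j hj)]
      exact hw'

/-- The dimer configurations that squish to `D` correspond to the choices of an incident hexagon
for every edge of multiplicity one. -/
theorem ncard_squish_eq (hD : IsDoubleDimer S D) :
    {M | IsDimer (squishVertex ⁻¹' S) M ∧ squish M = D}.ncard =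
      Nat.card {s // IsChoice {e | D e = 1} s} := by
  rw [← Nat.card_coe_set_eq]
  symm
  apply Nat.card_eq_of_bijective
    (fun s => ⟨dimerOf hD s.1, isDimer_dimerOf hD s.2, squish_dimerOf hD s.2⟩ :
      {s // IsChoice {e | D e = 1} s} → {M | IsDimer (squishVertex ⁻¹' S) M ∧ squish M = D})
  constructor
  · intro s t h
    exact Subtype.ext (dimerOf_injOn hD s.2 (congrArg Subtype.val h))
  · rintro ⟨M, hM, hMD⟩
    obtain ⟨s, hs, h⟩ := exists_choice hD hM hMD
    exact ⟨⟨s, hs⟩, Subtype.ext (dimerOf_eq hD hM hs h)⟩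

/-! ### Boxes -/

lemma exists_height_iff (x y z : ℕ) (p : ℤ × ℤ) :
    (∃ k : ℤ, (0 ≤ k ∧ k ≤ z) ∧ (0 ≤ p.1 + k ∧ p.1 + k ≤ x) ∧ (0 ≤ p.2 + k ∧ p.2 + k ≤ y)) ↔
      -z ≤ p.1 ∧ p.1 ≤ x ∧ -z ≤ p.2 ∧ p.2 ≤ y ∧ p.1 - p.2 ≤ x ∧ p.2 - p.1 ≤ y := by
  constructor
  · rintro ⟨k, h⟩
    omega
  · intro h
    -- The least shift that makes all three coordinates nonnegative.
    exact ⟨max 0 (max (-p.1) (-p.2)), by omega⟩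

lemma mem_box_iff (x y z : ℕ) (v : Vertex) :
    v ∈ box x y z ↔ ∀ k : Fin 3, -z ≤ (corner v k).1 ∧ (corner v k).1 ≤ x ∧
      -z ≤ (corner v k).2 ∧ (corner v k).2 ≤ y ∧ (corner v k).1 - (corner v k).2 ≤ x ∧
      (corner v k).2 - (corner v k).1 ≤ y := by
  simp only [box, Set.mem_ofPred_eq, exists_height_iff, mem_corners_iff, forall_exists_index,
    forall_eq_apply_imp_iff]

lemma preimage_box (x y z : ℕ) :
    squishVertex ⁻¹' box x y z = box (2 * x) (2 * y) (2 * z) := by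
  ext u
  rw [Set.mem_preimage]
  rcases center_or_leg u with hu | ⟨k, hu⟩
  all_goals
    generalize squishVertex u = w at *
    subst hu
    simp only [mem_box_iff, Fin.forall_fin_succ]
    obtain ⟨a, b, _ | _⟩ := w
  · simp [center, corner]; omega
  · simp [center, corner]; omega
  · fin_cases k <;> simp [leg, nbr, center, corner] <;> omega
  · fin_cases k <;> simp [leg, nbr, center, corner] <;> omega

/-- The direction of the dimer at a vertex in the dimer configuration that belongs to the empty
room. -/
def roomIndex : Vertex → Fin 3
  | (x, y, false) => if 0 ≤ x ∧ 0 ≤ y then 0 else if y < 0 ∧ y ≤ x then 2 else 1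
  | (x, y, true) => if 0 ≤ x ∧ 0 ≤ y then 0 else if y < 0 ∧ y < x then 2 else 1

lemma roomIndex_nbr (v : Vertex) : roomIndex (nbr v (roomIndex v)) = roomIndex v := by
  obtain ⟨x, y, _ | _⟩ := v <;> simp only [roomIndex] <;> split_ifs <;>
    simp only [nbr, cons_val] <;> grind [roomIndex]

/-- The empty-room matching of the plane preserves each box, hence also the complement of the box.
-/
lemma nbr_roomIndex_mem_box {x y z : ℕ} {v : Vertex} (h : v ∈ box x y z) :
    nbr v (roomIndex v) ∈ box x y z := by
  rw [mem_box_iff] at *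
  simp only [Fin.forall_fin_succ] at *
  obtain ⟨a, b, _ | _⟩ := v <;> simp only [roomIndex] at * <;> split_ifs <;>
    simp [nbr, corner] at * <;> omega

open Classical in
/-- A double dimer configuration on a box extends to one of the plane. -/
lemma exists_extension {x y z : ℕ} {D : Sym2 Vertex → ℕ} (hD : IsDoubleDimer (box x y z) D) :
    ∃ D', IsDoubleDimer Set.univ D' ∧ ∀ e, D e ≠ 0 → D' e = D e := by
  have key {w v : Vertex} {j : Fin 3} (hw : w ∉ box x y z)
      (h : s(v, nbr v j) = s(w, nbr w (roomIndex w))) : v ∉ box x y z ∧ j = roomIndex v := by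
    obtain ⟨rfl, rfl | rfl⟩ := (edge_eq_iff _ _ _ _).1 h
    · exact ⟨hw, rfl⟩
    · refine ⟨fun h' => hw ?_, (roomIndex_nbr w).symm⟩
      have := nbr_roomIndex_mem_box h'
      rwa [roomIndex_nbr, nbr_nbr] at this
  -- Outside the box every empty-room dimer is doubled.
  refine ⟨fun e => D e + if ∃ w ∉ box x y z, e = s(w, nbr w (roomIndex w)) then 2 else 0,
    ⟨fun e he => ⟨?_, by simp⟩, fun v _ => ?_⟩, fun e he => ?_⟩
  · by_cases h : D e = 0
    · simp only [h, zero_add, ne_eq, ite_eq_right_iff, OfNat.ofNat_ne_zero, imp_false,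
        not_not] at he
      obtain ⟨w, -, rfl⟩ := he
      exact adj_nbr _ _
    · exact (hD.1 e h).1
  · rw [Finset.sum_add_distrib]
    by_cases hv : v ∈ box x y z
    · rw [hD.2 v hv, Finset.sum_eq_zero, add_zero]
      intro j _
      rw [if_neg]
      rintro ⟨w, hw, h⟩
      exact (key hw h).1 hv
    · rw [Finset.sum_eq_zero (fun j _ => not_imp_comm.1 (hD.mem (j := j)) hv),
        Finset.sum_eq_single (roomIndex v), if_pos ⟨v, hv, rfl⟩]
      · intro j _ hj
        rw [if_neg]
        rintro ⟨w, hw, h⟩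
        exact hj (key hw h).2
      · simp
  · have : ¬ ∃ w ∉ box x y z, e = s(w, nbr w (roomIndex w)) := by
      rintro ⟨w, hw, rfl⟩
      exact hw (hD.mem he)
    simp [this]

/-! ### The height function -/

lemma exists_antidifference (f : ℤ → ℤ) : ∃ F : ℤ → ℤ, F 0 = 0 ∧ ∀ x, F (x + 1) = F x + f x := by
  refine ⟨fun x => match x with
    | Int.ofNat m => ∑ i ∈ Finset.range m, f i
    | Int.negSucc m => -∑ i ∈ Finset.range (m + 1), f (-(i + 1)), by simp, ?_⟩
  rintro (m | _ | m)
  · exact Finset.sum_range_succ _ _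
  · simp
  · change -∑ i ∈ Finset.range (m + 1), f (-(i + 1)) = 
      -∑ i ∈ Finset.range (m + 1 + 1), f (-(i + 1)) + f (Int.negSucc (m + 1))
    rw [Finset.sum_range_succ _ (m + 1), Int.negSucc_eq]
    push_cast
    ring

/-- A closed discrete 1-form on ℤ² is exact: sum along the axis `y = 0`, then vertically. -/
lemma exists_potential (a b : ℤ → ℤ → ℤ)
    (hab : ∀ x y, a x y + b (x + 1) y = b x y + a x (y + 1)) :
    ∃ h : ℤ → ℤ → ℤ, (∀ x y, h (x + 1) y = h x y + a x y) ∧ ∀ x y, h x (y + 1) = h x y + b x y := by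
  obtain ⟨F, -, hF⟩ := exists_antidifference fun x => a x 0
  choose G hG0 hG using fun x => exists_antidifference (b x)
  refine ⟨fun x y => F x + G x y, fun x y => ?_, fun x y => by simp only [hG]; ring⟩
  induction y using Int.induction_on with
  | zero => simp only [hG0, hF]; ring
  | succ y ih =>
    have := hab x y
    simp only [hG] at *
    linarith
  | pred y ih =>
    have := hab x (-y - 1)
    have h1 := hG x (-y - 1)
    have h2 := hG (x + 1) (-y - 1)
    simp only [sub_add_cancel] at *
    linarith

/-- The height changes by ±(2 - 3 `D e`) across an edge `e`. These increments sum to 6 - 3 · 2 = 0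
around a vertex, so they integrate. Only the jump ±2 across an edge of multiplicity zero is needed
later. -/
lemma exists_heightFunction {D : Sym2 Vertex → ℕ} (hD : IsDoubleDimer Set.univ D) :
    ∃ h : ℤ × ℤ → ℤ, ∀ v k, D s(v, nbr v k) = 0 →
      h (corner v (k + 1)) - h (corner v (k + 2)) = 2 ∨
      h (corner v (k + 1)) - h (corner v (k + 2)) = -2 := by
  set g : Vertex → Fin 3 → ℤ := fun v k => 2 - 3 * D s(v, nbr v k) with hg
  have hs (v : Vertex) (k : Fin 3) : g (nbr v k) k = g v k := by simp only [hg, edge_symm]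
  have h0 (v : Vertex) : g v 0 + g v 1 + g v 2 = 0 := by
    have := hD.2 v trivial
    rw [Fin.sum_univ_three] at this
    simp only [hg]
    omega
  obtain ⟨h, ha, hb⟩ := exists_potential (fun x y => -g (x, y, false) 1)
    (fun x y => -g (x, y, true) 2) (by
      intro x y
      have h1 := h0 (x, y, false)
      have h2 := h0 (x, y, true)
      have h3 : g (x + 1, y, true) 2 = g (x, y, false) 2 := hs (x, y, false) 2
      have h4 : g (x, y + 1, false) 1 = g (x, y, true) 1 := hs (x, y, true) 1
      have h5 : g (x, y, true) 0 = g (x, y, false) 0 := hs (x, y, false) 0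
      linarith)
  refine ⟨fun p => h p.1 p.2, fun v k hk => ?_⟩
  have hgk : g v k = 2 := by simp [hg, hk]
  obtain ⟨x, y, _ | _⟩ := v
  · left
    have h1 := h0 (x, y, false)
    have h3 : g (x + 1, y, true) 2 = g (x, y, false) 2 := hs (x, y, false) 2
    have h4 := ha x y
    have h5 := hb (x + 1) y
    fin_cases k <;> simp [corner] at * <;> linarith
  · right
    have h1 := h0 (x, y, true)
    have h3 : g (x, y + 1, false) 1 = g (x, y, true) 1 := hs (x, y, true) 1
    have h4 := hb x y
    have h5 := ha x (y + 1)
    fin_cases k <;> simp [corner] at * <;> linarith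

/-! ### Closed index sequences -/

/-- The bi-infinite running of a cycle with `n` vertices: `v i` is the `i`-th vertex, and the step
from it goes along its `j i`-th edge. -/
structure IsCyclic (n : ℕ) (v : ℕ → Vertex) (j : ℕ → Fin 3) : Prop where
  three_le : 3 ≤ n
  step : ∀ i, v (i + 1) = nbr (v i) (j i)
  periodic : ∀ i, v (i + n) = v i
  inj : ∀ i k, v i = v k → i ≡ k [MOD n]

namespace IsCyclic

variable {n : ℕ} {v : ℕ → Vertex} {j : ℕ → Fin 3}

lemma eq_of_modEq (h : IsCyclic n v j) {i k : ℕ} (hik : i ≡ k [MOD n]) : v i = v k := by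
  have h1 (i : ℕ) : v (i % n) = v i := Function.Periodic.map_mod_nat h.periodic i
  rw [← h1 i, hik, h1]

lemma index_eq_of_modEq (h : IsCyclic n v j) {i k : ℕ} (hik : i ≡ k [MOD n]) : j i = j k := by
  apply nbr_injective (v i)
  rw [← h.step, h.eq_of_modEq (hik.add_right 1), h.step, h.eq_of_modEq hik]

lemma index_periodic (h : IsCyclic n v j) (i : ℕ) : j (i + n) = j i :=
  h.index_eq_of_modEq (by simp)

/-- Repeating the index would backtrack, and then `n` would divide 2. -/
lemma index_succ_ne (h : IsCyclic n v j) (i : ℕ) : j (i + 1) ≠ j i := by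
  intro hj
  have h1 : v (i + 2) = v i := by
    rw [h.step, hj, h.step, nbr_nbr]
  have h2 := (Nat.modEq_iff_dvd' (by omega)).1 (h.inj _ _ h1).symm
  rw [Nat.add_sub_cancel_left] at h2
  have := Nat.le_of_dvd (by norm_num) h2
  have := h.three_le
  omega

lemma index_succ (h : IsCyclic n v j) (i : ℕ) : j (i + 1) = j i - 1 ∨ j (i + 1) = j i + 1 := by
  have := h.index_succ_ne i
  revert this
  generalize j (i + 1) = a
  generalize j i = b
  revert a b
  decide

/-- The `i`-th edge. -/
def stepEdge (v : ℕ → Vertex) (i : ℕ) : Sym2 Vertex := s(v i, v (i + 1))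

lemma edge_eq (h : IsCyclic n v j) (i : ℕ) : stepEdge v i = s(v i, nbr (v i) (j i)) := by
  rw [stepEdge, h.step]

lemma edge_eq' (h : IsCyclic n v j) (i : ℕ) :
    stepEdge v i = s(v (i + 1), nbr (v (i + 1)) (j i)) := by
  rw [stepEdge, h.step, nbr_nbr, Sym2.eq_swap]

lemma edge_eq_of_modEq (h : IsCyclic n v j) {i k : ℕ} (hik : i ≡ k [MOD n]) :
    stepEdge v i = stepEdge v k := by
  rw [stepEdge, stepEdge, h.eq_of_modEq hik, h.eq_of_modEq (hik.add_right 1)]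

lemma modEq_of_edge_eq (h : IsCyclic n v j) {i k : ℕ} (hik : stepEdge v i = stepEdge v k) :
    i ≡ k [MOD n] := by
  rw [h.edge_eq, h.edge_eq, edge_eq_iff] at hik
  obtain ⟨h1, h2 | h2⟩ := hik
  · exact h.inj _ _ h2
  · rw [← h.step] at h2
    refine absurd ?_ (h.index_succ_ne k)
    rw [← h1, h.index_eq_of_modEq (h.inj _ _ h2)]

/-- The number of right turns along a loop of a double dimer configuration is even. -/
lemma prod_turn_sign (h : IsCyclic n v j) {D : Sym2 Vertex → ℕ} (hD : IsDoubleDimer Set.univ D)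
    (hl : ∀ i, D (stepEdge v i) = 1) :
    ∏ i ∈ Finset.range n, (if j (i + 1) = j i - 1 then 1 else -1 : ℤ) = 1 := by
  obtain ⟨H, hH⟩ := exists_heightFunction hD
  -- The height of the hexagon on the left of the `i`-th step.
  set c : ℕ → ℤ := fun i => H (corner (v i) (j i - 1)) with hc
  have key (i : ℕ) : (j (i + 1) = j i - 1 ∧ c (i + 1) = c i) ∨
      (j (i + 1) ≠ j i - 1 ∧ (c (i + 1) - c i = 2 ∨ c (i + 1) - c i = -2)) := by
    have h1 : corner (v i) (j i - 1) = corner (v (i + 1)) (j i + 1) := by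
      rw [h.step, ← corner_nbr (v i) (j := j i) (by simp)]
      congr 1
      generalize j i = a
      revert a
      decide
    rcases h.index_succ i with h2 | h2
    · refine Or.inl ⟨h2, ?_⟩
      simp only [hc]
      rw [h1, h2]
      congr 2
      generalize j i = a
      revert a
      decide
    · refine Or.inr ⟨?_, ?_⟩
      · rw [h2]
        generalize j i = a
        revert a
        decide
      -- At a right turn the left hexagons before and after are separated by the third edge at the
      -- vertex, whose multiplicity is 2 - 1 - 1 = 0.
      · have h3 := hl i
        have h4 := hl (i + 1)
        rw [h.edge_eq'] at h3
        rw [h.edge_eq, h2] at h4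
        have h5 := hD.sum_eq (v := v (i + 1)) trivial (i := j i) (j := j i + 1) (by simp)
        have h6 : -j i - (j i + 1) = j i + 2 := by
          generalize j i = a
          revert a
          decide
        rw [h3, h4, h6] at h5
        have h7 := hH (v (i + 1)) (j i + 2) (by omega)
        have h8 : j i + 2 + 1 = j i := by
          generalize j i = a
          revert a
          decide
        have h9 : j i + 2 + 2 = j i + 1 := by
          generalize j i = a
          revert a
          decide
        rw [h8, h9] at h7
        simp only [hc]
        rw [h1, h2, add_sub_cancel_right]
        exact h7
  -- The sign of the first `m` turns is recorded by the change of `c` modulo 4, which vanishes after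
  -- a full round.
  have main (m : ℕ) :
      (∏ i ∈ Finset.range m, (if j (i + 1) = j i - 1 then 1 else -1 : ℤ) = 1 ∧
        (c m - c 0) % 4 = 0) ∨
      (∏ i ∈ Finset.range m, (if j (i + 1) = j i - 1 then 1 else -1 : ℤ) = -1 ∧
        (c m - c 0) % 4 = 2) := by
    induction m with
    | zero => simp
    | succ m ih =>
      rw [Finset.prod_range_succ]
      rcases key m with ⟨h1, h2⟩ | ⟨h1, h2⟩
      · rw [if_pos h1, mul_one, h2]
        exact ih
      · rw [if_neg h1]
        rcases ih with ⟨h3, h4⟩ | ⟨h3, h4⟩ <;> rw [h3]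
        · exact Or.inr ⟨rfl, by omega⟩
        · exact Or.inl ⟨rfl, by omega⟩
  rcases main n with h1 | ⟨-, h1⟩
  · exact h1.1
  · have : c n = c 0 := by
      have h1 := h.periodic 0
      have h2 := h.index_periodic 0
      rw [zero_add] at h1 h2
      simp only [hc]
      rw [h1, h2]
    rw [this, sub_self] at h1
    norm_num at h1

end IsCyclic

/-! ### Turn matrices and the connection -/

/-- The product of the first `n` terms, later terms to the left. -/
def leftProd {G : Type*} [Monoid G] (g : ℕ → G) (n : ℕ) : G :=
  ((List.range n).map g).reverse.prod

@[simp] lemma leftProd_zero {G : Type*} [Monoid G] (g : ℕ → G) : leftProd g 0 = 1 := rfl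

lemma leftProd_succ {G : Type*} [Monoid G] (g : ℕ → G) (n : ℕ) :
    leftProd g (n + 1) = g n * leftProd g n := by
  simp [leftProd, List.range_succ]

/-- With `rightFactor`, a factorisation of the connection at `a = b = c = 1`. -/
noncomputable def leftFactor : Fin 6 → Matrix (Fin 2) (Fin 2) ℂ :=
  ![Complex.I • turnL, -matJ, -Complex.I • turnR, -turnL, Complex.I • matJ, turnR]

/-- See `leftFactor`. -/
noncomputable def rightFactor : Fin 6 → Matrix (Fin 2) (Fin 2) ℂ :=
  ![turnR * matJ, -Complex.I • 1, -(turnL * matJ), Complex.I • (turnR * matJ), -1,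
    -Complex.I • (turnL * matJ)]

lemma det_rightFactor_ne_zero (h : Fin 6) : (rightFactor h).det ≠ 0 := by
  fin_cases h <;> simp [rightFactor, turnL, turnR, matJ, det_fin_two]

/-- The nontrivial cases rest on R J R = L and L J L = -R. The scalars in the two tables are
arranged so that the result does not depend on the heading, here and in
`rightFactor_mul_leftFactor_right`. -/
lemma rightFactor_mul_leftFactor_left (h : Fin 6) :
    rightFactor (h + 1) * leftFactor h = turnL := by
  fin_cases h <;> ext i j <;> fin_cases i <;> fin_cases j <;>
    simp [leftFactor, rightFactor, turnL, turnR, matJ, Matrix.mul_apply, Fin.sum_univ_two]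

lemma rightFactor_mul_leftFactor_right (h : Fin 6) :
    rightFactor (h - 1) * leftFactor h = -turnR := by
  fin_cases h <;> ext i j <;> fin_cases i <;> fin_cases j <;>
    simp [leftFactor, rightFactor, turnL, turnR, matJ, Matrix.mul_apply, Fin.sum_univ_two]

lemma coe_mul_eq (g h : SpecialLinearGroup (Fin 2) ℂ) :
    ((g * h : SpecialLinearGroup (Fin 2) ℂ) : Matrix (Fin 2) (Fin 2) ℂ) =
      (g : Matrix (Fin 2) (Fin 2) ℂ) * (h : Matrix (Fin 2) (Fin 2) ℂ) :=
  Matrix.SpecialLinearGroup.coe_mul g h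

lemma coe_inv_of_eq {g : SpecialLinearGroup (Fin 2) ℂ} {a b c d : ℂ}
    (h : (g : Matrix (Fin 2) (Fin 2) ℂ) = !![a, b; c, d]) :
    ((g⁻¹ : SpecialLinearGroup (Fin 2) ℂ) : Matrix (Fin 2) (Fin 2) ℂ) = !![d, -b; -c, a] := by
  exact (Matrix.SpecialLinearGroup.coe_inv g).trans (by rw [h, adjugate_fin_two_of])

lemma connection_eq {ω : ℂˣ} (hω : ω = 1 ∨ ω = -1) (v w : Vertex) :
    (connection ω ω ω v w : Matrix (Fin 2) (Fin 2) ℂ) =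
      (ω : ℂ) • (leftFactor (heading v w) * rightFactor (heading v w)) := by
  -- This is where ω = ±1 enters: the edge matrices A, B, C all become ω times the identity.
  have hω' : (ω : ℂ)⁻¹ = ω := by rcases hω with rfl | rfl <;> simp
  have h1 : (alpha ω : Matrix (Fin 2) (Fin 2) ℂ) =
      !![ω * Complex.I, 0; 0, -(ω * Complex.I)] := by
    simp [alpha, matA, matJ, hω', mul_comm]
  have h2 : (beta ω : Matrix (Fin 2) (Fin 2) ℂ) =
      !![ω * Complex.I, -2 * (ω * Complex.I); 0, -(ω * Complex.I)] := by
    ext i j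
    fin_cases i <;> fin_cases j <;> simp [beta, matB, matJ, turnL, turnR, hω'] <;> ring
  have h3 : (gamma ω : Matrix (Fin 2) (Fin 2) ℂ) =
      !![-(ω * Complex.I), 0; -2 * (ω * Complex.I), ω * Complex.I] := by
    ext i j
    fin_cases i <;> fin_cases j <;> simp [gamma, matC, matJ, turnL, turnR, hω'] <;> ring
  have h4 := coe_inv_of_eq h1
  have h5 := coe_inv_of_eq h2
  have h6 := coe_inv_of_eq h3
  rw [connection]
  generalize heading v w = h
  fin_cases h
  · refine h6.trans ?_
    simp [leftFactor, rightFactor, turnL, turnR, matJ]; ring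
  · refine h1.trans ?_
    simp [leftFactor, rightFactor, matJ]
  · refine h2.trans ?_
    simp [leftFactor, rightFactor, turnL, turnR, matJ]; ring
  · refine h3.trans ?_
    simp [leftFactor, rightFactor, turnL, turnR, matJ]; ring
  · refine h4.trans ?_
    simp [leftFactor, rightFactor, matJ]
  · refine h5.trans ?_
    simp [leftFactor, rightFactor, turnL, turnR, matJ]; ring

lemma heading_nbr (v : Vertex) (j : Fin 3) :
    heading v (nbr v j) = if v.2.2 then ![3, 5, 1] j else ![0, 2, 4] j := by
  obtain ⟨x, y, _ | _⟩ := v <;> fin_cases j <;> simp [heading, nbr]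

lemma heading_left (v : Vertex) (j : Fin 3) :
    heading (nbr v j) (nbr (nbr v j) (j - 1)) = heading v (nbr v j) + 1 := by
  rw [heading_nbr, heading_nbr, nbr_color]
  cases v.2.2 <;> fin_cases j <;> rfl

lemma heading_right (v : Vertex) (j : Fin 3) :
    heading (nbr v j) (nbr (nbr v j) (j + 1)) = heading v (nbr v j) - 1 := by
  rw [heading_nbr, heading_nbr, nbr_color]
  cases v.2.2 <;> fin_cases j <;> rfl

namespace IsCyclic

variable {n : ℕ} {v : ℕ → Vertex} {j : ℕ → Fin 3}

/-- The heading of the `i`-th step. -/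
def headingAt (v : ℕ → Vertex) (i : ℕ) : Fin 6 := heading (v i) (v (i + 1))

/-- The turn matrix at the end of the `i`-th step. -/
def turnAt (v : ℕ → Vertex) (i : ℕ) : Matrix (Fin 2) (Fin 2) ℂ :=
  turn (headingAt v i) (headingAt v (i + 1))

lemma headingAt_left (h : IsCyclic n v j) {i : ℕ} (hi : j (i + 1) = j i - 1) :
    headingAt v (i + 1) = headingAt v i + 1 := by
  rw [headingAt, headingAt, h.step (i + 1), hi, h.step i, heading_left]

lemma headingAt_right (h : IsCyclic n v j) {i : ℕ} (hi : j (i + 1) = j i + 1) :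
    headingAt v (i + 1) = headingAt v i - 1 := by
  rw [headingAt, headingAt, h.step (i + 1), hi, h.step i, heading_right]

lemma turnAt_eq (h : IsCyclic n v j) (i : ℕ) :
    turnAt v i = if j (i + 1) = j i - 1 then turnL else turnR := by
  rcases h.index_succ i with hi | hi
  · rw [if_pos hi, turnAt, h.headingAt_left hi, turn, if_pos rfl]
  · rw [if_neg, turnAt, h.headingAt_right hi, turn, if_neg]
    · generalize headingAt v i = a; revert a; decide
    · rw [hi]; generalize j i = a; revert a; decide

lemma rightFactor_mul_leftFactor (h : IsCyclic n v j) (i : ℕ) :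
    rightFactor (headingAt v (i + 1)) * leftFactor (headingAt v i) =
      ((if j (i + 1) = j i - 1 then 1 else -1 : ℤ) : ℂ) • turnAt v i := by
  rw [h.turnAt_eq]
  rcases h.index_succ i with hi | hi
  · rw [if_pos hi, if_pos hi, h.headingAt_left hi, rightFactor_mul_leftFactor_left]
    simp
  · have : j (i + 1) ≠ j i - 1 := by
      rw [hi]; generalize j i = a; revert a; decide
    rw [if_neg this, if_neg this, h.headingAt_right hi, rightFactor_mul_leftFactor_right]
    simp

lemma color_eq (h : IsCyclic n v j) (i : ℕ) : (v i).2.2 = (v 0).2.2 ↔ Even i := by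
  induction i with
  | zero => simp
  | succ i ih =>
    rw [h.step, nbr_color, Nat.even_add_one, ← ih]
    cases (v i).2.2 <;> cases (v 0).2.2 <;> simp

lemma even_length (h : IsCyclic n v j) : Even n := by
  rw [← h.color_eq, ← h.periodic 0, zero_add]

lemma trace_leftProd (h : IsCyclic n v j) {ω : ℂˣ} (hω : ω = 1 ∨ ω = -1)
    (hs : ∏ i ∈ Finset.range n, (if j (i + 1) = j i - 1 then 1 else -1 : ℤ) = 1) :
    (((leftProd (fun i => connection ω ω ω (v i) (v (i + 1))) n :
      SpecialLinearGroup (Fin 2) ℂ)) : Matrix (Fin 2) (Fin 2) ℂ).trace = (leftProd (turnAt v) n).trace := by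
  -- Each partial product telescopes into turn matrices. After a full round the heading returns, so
  -- the monodromy is conjugate to the turn product by `rightFactor` of the initial heading.
  have key (m : ℕ) : rightFactor (headingAt v m) *
      ((leftProd (fun i => connection ω ω ω (v i) (v (i + 1))) m :
        SpecialLinearGroup (Fin 2) ℂ) : Matrix (Fin 2) (Fin 2) ℂ) =
      ((ω : ℂ) ^ m * ((∏ i ∈ Finset.range m, (if j (i + 1) = j i - 1 then 1 else -1 : ℤ) : ℤ) : ℂ)) •
        (leftProd (turnAt v) m * rightFactor (headingAt v 0)) := by
    induction m with
    | zero => simp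
    | succ m ih =>
      rw [leftProd_succ, leftProd_succ, coe_mul_eq, connection_eq hω,
        Finset.prod_range_succ, ← headingAt, Matrix.smul_mul, Matrix.mul_smul, Matrix.mul_assoc,
        ← Matrix.mul_assoc, h.rightFactor_mul_leftFactor, ih, Matrix.smul_mul, Matrix.mul_smul,
        smul_smul, smul_smul, Matrix.mul_assoc]
      congr 1
      push_cast
      ring
  have h1 := key n
  have h2 : headingAt v n = headingAt v 0 := by
    rw [headingAt, headingAt, ← zero_add n, h.periodic, add_right_comm, h.periodic]
  have h3 : (ω : ℂ) ^ n = 1 := by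
    rcases hω with rfl | rfl
    · simp
    · simp [h.even_length.neg_one_pow]
  rw [hs, h2, h3] at h1
  have hu : IsUnit (rightFactor (headingAt v 0)).det := (det_rightFactor_ne_zero _).isUnit
  have h4 := congrArg (fun A => ((rightFactor (headingAt v 0))⁻¹ * A).trace) h1
  simp only [nonsing_inv_mul_cancel_left _ _ hu, Int.cast_one, mul_one, one_smul] at h4
  rw [h4, Matrix.trace_mul_comm, Matrix.mul_assoc, Matrix.mul_nonsing_inv _ hu, Matrix.mul_one]

end IsCyclic

/-! ### The transfer matrix -/

/-- Expansion of a matrix product as a sum over state sequences; columns are the earlier states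
because later factors stand to the left. -/
lemma leftProd_apply (T : ℕ → Matrix (Fin 2) (Fin 2) ℂ) (n : ℕ) (b a : Fin 2) :
    leftProd T n b a = ∑ s : Fin (n + 1) → Fin 2,
      if s 0 = a ∧ s (Fin.last n) = b then
        ∏ i : Fin n, T i (s i.succ) (s i.castSucc) else 0 := by
  induction n generalizing b with
  | zero =>
    rw [← (Equiv.funUnique (Fin 1) (Fin 2)).symm.sum_comp]
    simp only [leftProd_zero, Equiv.funUnique_symm_apply, uniqueElim_const, Fin.last_zero,
      Finset.univ_eq_empty, Finset.prod_empty, Matrix.one_apply]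
    fin_cases a <;> fin_cases b <;> simp
    all_goals
      rw [eq_comm, Nat.cast_eq_zero, Finset.card_eq_zero, Finset.filter_eq_empty_iff]
      rintro x - ⟨h, h'⟩
      simp [h] at h'
  | succ n ih =>
    rw [leftProd_succ, Matrix.mul_apply, ← (Fin.snocEquiv fun _ => Fin 2).sum_comp,
      Fintype.sum_prod_type]
    simp only [ih, Finset.mul_sum]
    have h0 (x : Fin 2) (s : Fin (n + 1) → Fin 2) :
        (Fin.snocEquiv fun _ => Fin 2) (x, s) 0 = s 0 := by
      rw [← Fin.castSucc_zero]
      exact Fin.snoc_castSucc (α := fun _ => Fin 2) x s 0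
    have h1 (x : Fin 2) (s : Fin (n + 1) → Fin 2) (i : Fin (n + 1)) :
        (Fin.snocEquiv fun _ => Fin 2) (x, s) i.castSucc = s i :=
      Fin.snoc_castSucc (α := fun _ => Fin 2) x s i
    have h2 (x : Fin 2) (s : Fin (n + 1) → Fin 2) :
        (Fin.snocEquiv fun _ => Fin 2) (x, s) (Fin.last (n + 1)) = x :=
      Fin.snoc_last (α := fun _ => Fin 2) x s
    simp only [Fin.prod_univ_castSucc, Fin.succ_castSucc, h0, h1, h2, Fin.succ_last]
    rw [Finset.sum_comm]
    rw [Finset.sum_comm (s := Finset.univ (α := Fin 2))]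
    refine Finset.sum_congr rfl fun s _ => ?_
    rw [Finset.sum_eq_single (s (Fin.last n)), Finset.sum_eq_single b]
    · by_cases h : s 0 = a <;> simp [h, mul_comm]
    · intro c _ hc
      simp [hc]
    · simp
    · intro c _ hc
      simp [hc.symm]
    · simp

lemma trace_leftProd_eq_card (T : ℕ → Matrix (Fin 2) (Fin 2) ℂ) (P : ℕ → Fin 2 → Fin 2 → Prop)
    (hT : ∀ i a b, P i a b → T i b a = 1) (hT' : ∀ i a b, ¬ P i a b → T i b a = 0) (n : ℕ) :
    (leftProd T n).trace = (Nat.card {s : Fin (n + 1) → Fin 2 //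
      s 0 = s (Fin.last n) ∧ ∀ i : Fin n, P i (s i.castSucc) (s i.succ)} : ℂ) := by
  classical
  rw [Nat.card_eq_fintype_card, Fintype.card_subtype, Finset.card_filter, Matrix.trace]
  push_cast
  simp only [Matrix.diag_apply, leftProd_apply]
  rw [Finset.sum_comm]
  refine Finset.sum_congr rfl fun s _ => ?_
  rw [Finset.sum_eq_single (s 0)]
  · by_cases h : s 0 = s (Fin.last n)
    · simp only [← h, true_and, and_self, if_true]
      split_ifs with h1
      · exact Finset.prod_eq_one fun i _ => hT _ _ _ (h1 i)
      · push Not at h1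
        obtain ⟨i, hi⟩ := h1
        exact Finset.prod_eq_zero (Finset.mem_univ i) (hT' _ _ _ hi)
    · simp [h, Ne.symm h]
  · intro c _ hc
    simp [hc.symm]
  · simp

namespace IsCyclic

variable {n : ℕ} {v : ℕ → Vertex} {j : ℕ → Fin 3}

/-- The hexagon on the left (`t = 0`) or on the right (`t = 1`) of the `i`-th step. -/
def side (v : ℕ → Vertex) (j : ℕ → Fin 3) (i : ℕ) (t : Fin 2) : ℤ × ℤ :=
  corner (v i) (if t = 0 then j i - 1 else j i + 1)

/-- The side to which the path turns after the `i`-th step. -/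
def inner (j : ℕ → Fin 3) (i : ℕ) : Fin 2 := if j (i + 1) = j i - 1 then 0 else 1

lemma side_eq_corner_succ (h : IsCyclic n v j) (i : ℕ) (t : Fin 2) :
    side v j i t = corner (v (i + 1)) (if t = 0 then j i + 1 else j i - 1) := by
  rw [side, h.step, ← corner_nbr (v i) (j := j i) (by split_ifs <;> simp)]
  congr 1
  generalize j i = a
  revert a t
  decide

/-- Two consecutive edges meet in a single hexagon, the one inside the turn. Hence every turn
forbids exactly one pair of states. -/
lemma side_eq_iff (h : IsCyclic n v j) (i : ℕ) (t t' : Fin 2) :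
    side v j i t = side v j (i + 1) t' ↔ t = inner j i ∧ t' = inner j i := by
  rw [h.side_eq_corner_succ, side, (corner_injective _).eq_iff, inner]
  rcases h.index_succ i with hi | hi <;> rw [hi] <;> generalize j i = a <;> revert a t t' <;>
    decide

lemma side_eq_of_modEq (h : IsCyclic n v j) {i k : ℕ} (hik : i ≡ k [MOD n]) :
    side v j i = side v j k := by
  funext t
  rw [side, side, h.eq_of_modEq hik, h.index_eq_of_modEq hik]

lemma side_injective (v : ℕ → Vertex) (j : ℕ → Fin 3) (i : ℕ) :
    Function.Injective (side v j i) := by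
  intro t t' h
  replace h := corner_injective _ h
  revert h
  generalize j i = a
  revert a t t'
  decide

lemma edge_ne_succ (h : IsCyclic n v j) (i : ℕ) : stepEdge v i ≠ stepEdge v (i + 1) := by
  intro h'
  rw [h.edge_eq', h.edge_eq, edge_eq_iff] at h'
  exact h.index_succ_ne i h'.1.symm

lemma edge_or_of_mem (h : IsCyclic n v j) {i k : ℕ} {w : Vertex} (hi : w ∈ stepEdge v i)
    (hk : w ∈ stepEdge v k) : i ≡ k [MOD n] ∨ i ≡ k + 1 [MOD n] ∨ i + 1 ≡ k [MOD n] := by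
  rcases Sym2.mem_iff.1 hi with rfl | rfl <;> rcases Sym2.mem_iff.1 hk with h' | h'
  · exact Or.inl (h.inj _ _ h')
  · exact Or.inr (Or.inl (h.inj _ _ h'))
  · exact Or.inr (Or.inr (h.inj _ _ h'))
  · exact Or.inl (Nat.ModEq.add_right_cancel' 1 (h.inj _ _ h'))

lemma exists_state (h : IsCyclic n v j) {σ : Set.range (stepEdge v) → ℤ × ℤ}
    (hσ : IsChoice (Set.range (stepEdge v)) σ) (i : ℕ) : ∃ t, σ ⟨stepEdge v i, i, rfl⟩ = side v j i t := by
  obtain ⟨k, hk, hk'⟩ := hσ.exists_corner ⟨stepEdge v i, i, rfl⟩ (h.edge_eq i)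
  have : k = j i - 1 ∨ k = j i + 1 := by
    clear hk'
    revert hk
    generalize j i = a
    revert a k
    decide
  rcases this with rfl | rfl
  · exact ⟨0, hk'⟩
  · exact ⟨1, hk'⟩

lemma exists_isChoice (h : IsCyclic n v j) {t : ℕ → Fin 2} (ht : ∀ i, t (i + n) = t i)
    (ht' : ∀ i, ¬ (t i = inner j i ∧ t (i + 1) = inner j i)) :
    ∃ σ, IsChoice (Set.range (stepEdge v)) σ ∧ ∀ i, σ ⟨stepEdge v i, i, rfl⟩ = side v j i (t i) := by
  have key : ∀ e : Set.range (stepEdge v), ∃ p, ∀ i, stepEdge v i = e.1 → p = side v j i (t i) := by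
    rintro ⟨_, i, rfl⟩
    refine ⟨side v j i (t i), fun k hk => ?_⟩
    have hik := h.modEq_of_edge_eq hk.symm
    have : t i = t k := by
      rw [← Function.Periodic.map_mod_nat ht i, hik, Function.Periodic.map_mod_nat ht k]
    rw [this, h.side_eq_of_modEq hik]
  choose σ hσ using key
  refine ⟨σ, ⟨?_, ?_⟩, fun i => hσ _ i rfl⟩
  · rintro ⟨_, i, rfl⟩ w hw
    rw [hσ _ i rfl, mem_corners_iff]
    rcases Sym2.mem_iff.1 hw with rfl | rfl
    · exact ⟨_, rfl⟩
    · exact ⟨_, h.side_eq_corner_succ _ _⟩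
  · rintro ⟨_, i, rfl⟩ ⟨_, k, rfl⟩ hne w hi hk heq
    rcases h.edge_or_of_mem hi hk with h' | h' | h'
    · exact hne (Subtype.ext (h.edge_eq_of_modEq h'))
    · rw [hσ _ (k + 1) (h.edge_eq_of_modEq h').symm, hσ _ k rfl] at heq
      exact ht' k ((h.side_eq_iff _ _ _).1 heq.symm)
    · rw [hσ _ i rfl, hσ _ (i + 1) (h.edge_eq_of_modEq h')] at heq
      exact ht' i ((h.side_eq_iff _ _ _).1 heq)

/-- The number of choices along a cycle is the trace of the product of its turn matrices. -/
theorem card_isChoice (h : IsCyclic n v j) :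
    (Nat.card {σ // IsChoice (Set.range (stepEdge v)) σ} : ℂ) = (leftProd (turnAt v) n).trace := by
  -- The only zero entry of `turnL` is at (0, 0) and that of `turnR` at (1, 1), matching the
  -- forbidden pairs.
  rw [trace_leftProd_eq_card (turnAt v) (fun i a b => ¬ (a = inner j i ∧ b = inner j i))]
  · congr 1
    have hex (σ : {σ // IsChoice (Set.range (stepEdge v)) σ}) (i : ℕ) := h.exists_state σ.2 i
    choose t ht using hex
    have hper (σ) {i k : ℕ} (hik : i ≡ k [MOD n]) : t σ i = t σ k := by
      apply side_injective v j k
      rw [← ht, ← h.side_eq_of_modEq hik, ← ht]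
      exact congrArg σ.1 (Subtype.mk_eq_mk.2 (h.edge_eq_of_modEq hik))
    have hn : 0 < n := by have := h.three_le; omega
    refine Nat.card_eq_of_bijective (fun σ => ⟨fun i => t σ i, ?_, ?_⟩) ⟨?_, ?_⟩
    · exact hper σ (by simp [Nat.ModEq])
    · rintro i ⟨h1, h2⟩
      have h3 := (h.side_eq_iff i (t σ i) (t σ (i + 1))).2 ⟨h1, h2⟩
      rw [← ht, ← ht] at h3
      refine σ.2.2 _ _ ?_ (v (i + 1)) ?_ ?_ h3
      · exact fun h' => h.edge_ne_succ i (congrArg Subtype.val h')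
      · exact Sym2.mem_mk_right _ _
      · exact Sym2.mem_mk_left _ _
    · intro σ τ hστ
      ext1
      funext ⟨e, i, hi⟩
      subst hi
      rw [ht σ, ht τ, hper σ (Nat.mod_modEq i n).symm, hper τ (Nat.mod_modEq i n).symm]
      have := congrFun (congrArg Subtype.val hστ) ⟨i % n, (Nat.mod_lt i hn).trans (Nat.lt_succ_self n)⟩
      exact congrArg _ this
    · rintro ⟨s, hs, hs'⟩
      -- The closed sequence of `n + 1` states is continued periodically; agreement at index `n`
      -- uses that its ends coincide.
      set u : ℕ → Fin 2 := fun i => s ⟨i % n, (Nat.mod_lt i hn).trans (Nat.lt_succ_self n)⟩ with hu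
      have hu1 (i : ℕ) (hi : i < n + 1) : u i = s ⟨i, hi⟩ := by
        rcases Nat.lt_succ_iff_lt_or_eq.1 hi with hi' | rfl
        · simp only [hu, Nat.mod_eq_of_lt hi']
        · simp only [hu, Nat.mod_self]
          exact hs
      have hu2 {i k : ℕ} (hik : i ≡ k [MOD n]) : u i = u k := by
        simp only [hu]
        congr 2
      obtain ⟨σ, hσ, hσ'⟩ := h.exists_isChoice (t := u) (fun i => hu2 (by simp)) (by
        intro i
        have hi := Nat.mod_lt i hn
        have h1 := hs' ⟨i % n, hi⟩
        have h2 : inner j (i % n) = inner j i := by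
          rw [inner, inner, h.index_eq_of_modEq (Nat.mod_modEq i n),
            h.index_eq_of_modEq ((Nat.mod_modEq i n).add_right 1)]
        rw [hu2 (Nat.mod_modEq i n).symm, hu2 ((Nat.mod_modEq i n).add_right 1).symm,
          hu1 _ (by omega), hu1 _ (by omega), ← h2]
        exact h1)
      refine ⟨⟨σ, hσ⟩, ?_⟩
      ext1
      funext i
      apply side_injective v j i
      change side v j i (t ⟨σ, hσ⟩ i) = _
      exact (ht ⟨σ, hσ⟩ i).symm.trans ((hσ' i).trans (by rw [hu1 _ i.2]))
  · intro i a b hab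
    rw [h.turnAt_eq]
    simp only [inner] at hab
    split_ifs at * <;> revert hab <;> fin_cases a <;> fin_cases b <;> simp [turnL, turnR]
  · intro i a b hab
    rw [not_not] at hab
    obtain ⟨rfl, rfl⟩ := hab
    rw [h.turnAt_eq, inner]
    split_ifs <;> simp [turnL, turnR]

end IsCyclic

/-! ### Loops as closed index sequences -/

open Squish.IsCyclic

/-- The function `f` is arbitrary so that edges, headings and connection matrices along `L` are all
translated by one statement. -/
lemma exists_isCyclic {v : Vertex} {L : honeycomb.Walk v v} (hL : L.IsCycle) :
    ∃ (w : ℕ → Vertex) (j : ℕ → Fin 3), IsCyclic L.length w j ∧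
      {u | u ∈ L.support} = Set.range w ∧
      ∀ {α : Type} (f : Vertex → Vertex → α), (L.darts.map fun d => f d.fst d.snd) =
        (List.range L.length).map fun i => f (w i) (w (i + 1)) := by
  have h3 := hL.three_le_length
  have hn : 0 < L.length := by omega
  set w : ℕ → Vertex := fun i => L.getVert (i % L.length) with hw
  have h0 (i : ℕ) (hi : i ≤ L.length) : w i = L.getVert i := by
    rcases hi.lt_or_eq with hi | rfl
    · simp only [hw, Nat.mod_eq_of_lt hi]
    · simp only [hw, Nat.mod_self, Walk.getVert_zero, Walk.getVert_length]
  have hper {i k : ℕ} (hik : i ≡ k [MOD L.length]) : w i = w k := by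
    simp only [hw]
    rw [hik]
  have hadj (i : ℕ) : honeycomb.Adj (w i) (w (i + 1)) := by
    have hi := Nat.mod_lt i hn
    rw [← hper (Nat.mod_modEq i _), ← hper ((Nat.mod_modEq i _).add_right 1), h0 _ hi.le, h0 _ hi]
    exact L.adj_getVert_succ hi
  choose j hj using hadj
  refine ⟨w, j, ⟨h3, hj, fun i => hper (by simp), fun i k hik => ?_⟩, ?_, fun f => ?_⟩
  · have hi := Nat.mod_lt i hn
    have hk := Nat.mod_lt k hn
    exact hL.getVert_injOn' (by rw [Set.mem_ofPred_eq]; omega) (by rw [Set.mem_ofPred_eq]; omega) hik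
  · ext u
    rw [Set.mem_ofPred_eq, Walk.mem_support_iff_exists_getVert]
    constructor
    · rintro ⟨i, rfl, hi⟩
      exact ⟨i, h0 i hi⟩
    · rintro ⟨i, rfl⟩
      exact ⟨_, rfl, (Nat.mod_lt i hn).le⟩
  · apply List.ext_getElem
    · simp
    · intro i h1 h2
      have hi : i < L.length := by simpa using h2
      simp only [List.getElem_map, List.getElem_range, Walk.fst_darts_getElem,
        Walk.snd_darts_getElem, h0 _ hi.le, h0 _ hi]
      rw [L.getVert_eq_support_getElem hi.le, L.getVert_eq_support_getElem hi]
      simp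

lemma edges_eq_range {v : Vertex} {L : honeycomb.Walk v v} {w : ℕ → Vertex} {j : ℕ → Fin 3}
    (h : IsCyclic L.length w j) (hL : ∀ {α : Type} (f : Vertex → Vertex → α),
      (L.darts.map fun d => f d.fst d.snd) =
        (List.range L.length).map fun i => f (w i) (w (i + 1))) :
    {e | e ∈ L.edges} = Set.range (stepEdge w) := by
  have h1 : L.edges = (List.range L.length).map (stepEdge w) := hL fun a b => s(a, b)
  have hn : 0 < L.length := by have := h.three_le; omega
  ext e
  rw [h1, Set.mem_ofPred_eq, List.mem_map]
  constructor
  · rintro ⟨i, -, rfl⟩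
    exact ⟨i, rfl⟩
  · rintro ⟨i, rfl⟩
    exact ⟨i % L.length, List.mem_range.2 (Nat.mod_lt i hn), h.edge_eq_of_modEq (Nat.mod_modEq i _)⟩

lemma monodromy_eq (ω : ℂˣ) {v : Vertex} {L : honeycomb.Walk v v} {w : ℕ → Vertex}
    (hL : ∀ {α : Type} (f : Vertex → Vertex → α), (L.darts.map fun d => f d.fst d.snd) =
        (List.range L.length).map fun i => f (w i) (w (i + 1))) :
    monodromy ω ω ω L = leftProd (fun i => connection ω ω ω (w i) (w (i + 1))) L.length := by
  rw [monodromy, hL]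
  rfl

lemma turnProduct_eq {v : Vertex} {L : honeycomb.Walk v v} {w : ℕ → Vertex} {j : ℕ → Fin 3}
    (h : IsCyclic L.length w j) (hL : ∀ {α : Type} (f : Vertex → Vertex → α),
      (L.darts.map fun d => f d.fst d.snd) =
        (List.range L.length).map fun i => f (w i) (w (i + 1))) :
    turnProduct L = leftProd (turnAt w) L.length := by
  rw [turnProduct, leftProd, headings, hL]
  congr 2
  apply List.ext_getElem
  · simp
  · intro i h1 h2
    have h3 := (Nat.mod_modEq (i + 1) L.length)
    simp only [List.getElem_zipWith, List.getElem_rotate, List.getElem_map, List.getElem_range,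
      List.length_map, List.length_range, turnAt, headingAt]
    rw [h.eq_of_modEq h3, h.eq_of_modEq (h3.add_right 1)]

open Classical in
lemma IsCyclic.isDoubleDimer {n : ℕ} {w : ℕ → Vertex} {j : ℕ → Fin 3} (h : IsCyclic n w j) :
    IsDoubleDimer (Set.range w) fun e => if e ∈ Set.range (stepEdge w) then 1 else 0 := by
  have hn : 0 < n := by have := h.three_le; omega
  refine ⟨fun e he => ?_, ?_⟩
  · have : e ∈ Set.range (stepEdge w) := by
      by_contra h'
      exact he (if_neg h')
    obtain ⟨i, rfl⟩ := this
    rw [h.edge_eq]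
    refine ⟨adj_nbr _ _, fun v hv => ?_⟩
    rcases Sym2.mem_iff.1 hv with rfl | rfl
    · exact ⟨i, rfl⟩
    · exact ⟨i + 1, h.step i⟩
  · rintro _ ⟨m, rfl⟩
    obtain ⟨i, hi⟩ : ∃ i, w m = w (i + 1) := by
      refine ⟨m + (n - 1), ?_⟩
      rw [show m + (n - 1) + 1 = m + n by omega, h.periodic]
    rw [hi]
    have key (k : Fin 3) : s(w (i + 1), nbr (w (i + 1)) k) ∈ Set.range (stepEdge w) ↔
        k ∈ ({j i, j (i + 1)} : Finset (Fin 3)) := by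
      rw [Finset.mem_insert, Finset.mem_singleton]
      constructor
      · rintro ⟨m, hm⟩
        have h1 : w (i + 1) ∈ stepEdge w m := by rw [hm]; simp
        rcases Sym2.mem_iff.1 h1 with h1 | h1
        · rw [h.edge_eq_of_modEq (h.inj _ _ h1).symm, h.edge_eq, edge_eq_iff] at hm
          exact Or.inr hm.1.symm
        · rw [h.edge_eq_of_modEq (Nat.ModEq.add_right_cancel' 1 (h.inj _ _ h1)).symm, h.edge_eq',
            edge_eq_iff] at hm
          exact Or.inl hm.1.symm
      · rintro (rfl | rfl)
        · exact ⟨i, h.edge_eq' i⟩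
        · exact ⟨i + 1, h.edge_eq _⟩
    simp only [key]
    rw [Finset.sum_ite_mem, Finset.univ_inter, Finset.sum_const, smul_eq_mul, mul_one,
      Finset.card_pair (h.index_succ_ne i).symm]

lemma card_isChoice_edges {v : Vertex} {L : honeycomb.Walk v v} (hL : L.IsCycle) :
    (Nat.card {σ // IsChoice {e | e ∈ L.edges} σ} : ℂ) = (turnProduct L).trace := by
  obtain ⟨w, j, h, -, hf⟩ := exists_isCyclic hL
  rw [edges_eq_range h hf, turnProduct_eq h hf, h.card_isChoice]

/-- The loop by itself is a double dimer configuration of its own vertex set, so `ncard_squish_eq`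
applies to it. -/
lemma ncard_configsOver {v : Vertex} {L : honeycomb.Walk v v} (hL : L.IsCycle) :
    (configsOver L).ncard = Nat.card {σ // IsChoice {e | e ∈ L.edges} σ} := by
  classical
  obtain ⟨w, j, h, hs, hf⟩ := exists_isCyclic hL
  have h1 := edges_eq_range h hf
  have h2 := h.isDoubleDimer
  rw [← h1, ← hs] at h2
  obtain ⟨D, hD, h3⟩ : ∃ D : Sym2 Vertex → ℕ, (∀ e, D e = if e ∈ L.edges then 1 else 0) ∧
      IsDoubleDimer {u | u ∈ L.support} D :=
    ⟨_, fun e => by by_cases he : e ∈ L.edges <;> simp [he], h2⟩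
  have h4 : {e | D e = 1} = {e | e ∈ L.edges} := by
    ext e
    simp [hD]
  rw [← h4, ← ncard_squish_eq h3, configsOver]
  congr! 6 with M e
  rw [hD]

lemma contribution_eq {x y z : ℕ} {ω : ℂˣ} (hω : ω = 1 ∨ ω = -1) {S : Set Vertex}
    (hS : S = Set.univ ∨ S = box x y z) {D : Sym2 Vertex → ℕ} (hD : IsDoubleDimer S D)
    {v : Vertex} {L : honeycomb.Walk v v} (hL : IsLoopOf D L) :
    contribution ω ω ω L = (turnProduct L).trace := by
  obtain ⟨w, j, h, -, hf⟩ := exists_isCyclic hL.1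
  obtain ⟨D', hD', hDD⟩ : ∃ D', IsDoubleDimer Set.univ D' ∧ ∀ e, D e ≠ 0 → D' e = D e := by
    rcases hS with rfl | rfl
    · exact ⟨D, hD, fun _ _ => rfl⟩
    · exact exists_extension hD
  have hl (i : ℕ) : D' (stepEdge w i) = 1 := by
    have h1 : stepEdge w i ∈ {e | e ∈ L.edges} := by
      rw [edges_eq_range h hf]
      exact ⟨i, rfl⟩
    have h2 := hL.2 _ h1
    rw [hDD _ (by omega), h2]
  rw [contribution, monodromy_eq ω hf, turnProduct_eq h hf]
  exact h.trace_leftProd hω (h.prod_turn_sign hD' hl)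

/-! ### Products over loops -/

/-- The condition on choices only relates edges with a common vertex, so it never couples two
different parts. -/
lemma card_isChoice_iUnion {ι : Type*} [Fintype ι] {E : Set (Sym2 Vertex)}
    {F : ι → Set (Sym2 Vertex)} (hE : E = ⋃ i, F i)
    (hF : ∀ i k, i ≠ k → ∀ e ∈ F i, ∀ f ∈ F k, ∀ v ∈ e, v ∉ f) :
    Nat.card {σ // IsChoice E σ} = ∏ i, Nat.card {σ // IsChoice (F i) σ} := by
  subst hE
  rw [← Nat.card_pi]
  have huniq {i k : ι} {e : Sym2 Vertex} (hi : e ∈ F i) (hk : e ∈ F k) : i = k := by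
    by_contra hik
    exact hF i k hik e hi e hk _ e.out_fst_mem e.out_fst_mem
  refine Nat.card_eq_of_bijective
    (fun σ i => ⟨fun e => σ.1 ⟨e.1, Set.mem_iUnion.2 ⟨i, e.2⟩⟩, ?_, ?_⟩) ⟨?_, ?_⟩
  · exact fun e v hv => σ.2.1 _ v hv
  · exact fun e f hef v he hf => σ.2.2 ⟨e.1, Set.mem_iUnion.2 ⟨i, e.2⟩⟩
      ⟨f.1, Set.mem_iUnion.2 ⟨i, f.2⟩⟩ (fun h => hef (Subtype.ext (Subtype.mk_eq_mk.1 h))) v he hf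
  · intro σ τ h
    ext1
    funext ⟨e, he⟩
    obtain ⟨i, hi⟩ := Set.mem_iUnion.1 he
    exact congrFun (congrArg Subtype.val (congrFun h i)) ⟨e, hi⟩
  · intro τ
    have hex (e : ↑(⋃ i, F i)) : ∃ i, e.1 ∈ F i := Set.mem_iUnion.1 e.2
    choose c hc using hex
    have hτ (i : ι) (e : F i) (h) : (τ (c ⟨e.1, h⟩)).1 ⟨e.1, hc ⟨e.1, h⟩⟩ = (τ i).1 e := by
      have h1 := hc ⟨e.1, h⟩
      have h2 : c ⟨e.1, h⟩ = i := huniq h1 e.2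
      generalize_proofs h3
      revert h3
      rw [h2]
      exact fun _ => rfl
    refine ⟨⟨fun e => (τ (c e)).1 ⟨e.1, hc e⟩, fun e => (τ (c e)).2.1 ⟨e.1, hc e⟩, ?_⟩, ?_⟩
    · intro e f hef v he hf
      have hcc : c e = c f := by
        by_contra hne
        exact hF _ _ hne _ (hc e) _ (hc f) v he hf
      have h1 : f.1 ∈ F (c e) := hcc ▸ hc f
      have h2 := (τ (c e)).2.2 ⟨e.1, hc e⟩ ⟨f.1, h1⟩
        (fun h => hef (Subtype.ext (Subtype.mk_eq_mk.1 h))) v he hf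
      rwa [← hτ (c e) ⟨f.1, h1⟩ f.2] at h2
    · funext i
      ext1
      funext e
      exact hτ i e _

/-- Different loops of a double dimer configuration have no common vertex. -/
lemma IsLoopOf.disjoint {S : Set Vertex} {D : Sym2 Vertex → ℕ} (hD : IsDoubleDimer S D)
    {u v : Vertex} {K : honeycomb.Walk u u} {L : honeycomb.Walk v v} (hK : IsLoopOf D K)
    (hL : IsLoopOf D L) (hKL : K.edges.Disjoint L.edges) {e f : Sym2 Vertex} (he : e ∈ K.edges)
    (hf : f ∈ L.edges) {x : Vertex} (hxe : x ∈ e) : x ∉ f := by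
  intro hxf
  obtain ⟨w, j, h, -, hw⟩ := exists_isCyclic hK.1
  have hE := edges_eq_range h hw
  have h1 : ∃ i, x = w (i + 1) := by
    have : e ∈ {e | e ∈ K.edges} := he
    rw [hE] at this
    obtain ⟨i, rfl⟩ := this
    rcases Sym2.mem_iff.1 hxe with rfl | rfl
    · have := h.three_le
      refine ⟨i + (K.length - 1), ?_⟩
      rw [show i + (K.length - 1) + 1 = i + K.length by omega, h.periodic]
    · exact ⟨i, rfl⟩
  obtain ⟨i, rfl⟩ := h1
  have hmem (k : ℕ) : stepEdge w k ∈ K.edges := by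
    have : stepEdge w k ∈ {e | e ∈ K.edges} := by rw [hE]; exact ⟨k, rfl⟩
    exact this
  obtain ⟨k, rfl⟩ := edge_eq_of_mem (L.edges_subset_edgeSet hf) hxf
  have d1 := hK.2 _ (hmem i)
  have d2 := hK.2 _ (hmem (i + 1))
  have d3 := hL.2 _ hf
  have n1 : k ≠ j i := by
    rintro rfl
    refine hKL ?_ hf
    rw [← h.edge_eq']
    exact hmem i
  have n2 : k ≠ j (i + 1) := by
    rintro rfl
    refine hKL ?_ hf
    rw [← h.edge_eq]
    exact hmem _
  rw [h.edge_eq'] at d1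
  rw [h.edge_eq] at d2
  -- Two edges of `K` and one of `L`, all distinct and of multiplicity one, would give the common
  -- vertex degree three.
  have h2 := hD.sum_eq (hD.mem (v := w (i + 1)) (j := k) (by omega)) (h.index_succ_ne i)
  have h3 : -j (i + 1) - j i = k := by
    have n3 := h.index_succ_ne i
    revert n1 n2 n3
    generalize j i = a
    generalize j (i + 1) = b
    clear * -
    revert a b k
    decide
  rw [h3] at h2
  omega

lemma SquishRegions.exists_box {S₁ S₂ : Set Vertex} (h : SquishRegions S₁ S₂) :
    S₁ = squishVertex ⁻¹' S₂ ∧ ∃ x y z, S₂ = Set.univ ∨ S₂ = Squish.box x y z := by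
  cases h with
  | plane => exact ⟨rfl, 0, 0, 0, Or.inl rfl⟩
  | box x y z => exact ⟨(preimage_box x y z).symm, x, y, z, Or.inr rfl⟩

end Squish

theorem mainTheorem5 (n : ℕ) (hn : n = 1 ∨ n = 2) (ω : ℂˣ) (hω : IsPrimitiveRoot ω n)
    (S₁ S₂ : Set Squish.Vertex) (hS : Squish.SquishRegions S₁ S₂)
    (D : Sym2 Squish.Vertex → ℕ) (hD : Squish.IsDoubleDimer S₂ D) :
    (∀ (v : Squish.Vertex) (L : Squish.honeycomb.Walk v v), Squish.IsLoopOf D L →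
      Squish.contribution ω ω ω L = ((Squish.configsOver L).ncard : ℂ) ∧
      Squish.contribution ω ω ω L = (Squish.turnProduct L).trace) ∧
    ∀ (k : ℕ) (v : Fin k → Squish.Vertex) (L : ∀ i, Squish.honeycomb.Walk (v i) (v i)),
      (∀ i, Squish.IsLoopOf D (L i)) →
      (∀ i j, i ≠ j → (L i).edges.Disjoint (L j).edges) →
      (∀ e, D e = 1 → ∃ i, e ∈ (L i).edges) →
      ∏ i, Squish.contribution ω ω ω (L i) =
        ({M : Squish.honeycomb.Subgraph | Squish.IsDimer S₁ M ∧ Squish.squish M = D}.ncard : ℂ) := by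
  have hω' : ω = 1 ∨ ω = -1 := by
    have h1 : ω ^ 2 = 1 := by
      rcases hn with rfl | rfl
      · rw [IsPrimitiveRoot.one_right_iff.1 hω, one_pow]
      · exact hω.pow_eq_one
    have h2 : (ω : ℂ) ^ 2 = 1 := by rw [← Units.val_pow_eq_pow_val, h1, Units.val_one]
    rcases sq_eq_one_iff.1 h2 with h | h
    · exact Or.inl (Units.ext h)
    · exact Or.inr (Units.ext h)
  obtain ⟨rfl, x, y, z, hS'⟩ := hS.exists_box
  have hc {v : Squish.Vertex} {L : Squish.honeycomb.Walk v v} (hL : Squish.IsLoopOf D L) :=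
    Squish.contribution_eq hω' hS' hD hL
  refine ⟨fun v L hL => ⟨?_, hc hL⟩, fun k v L hL hdisj hcov => ?_⟩
  · rw [hc hL, Squish.ncard_configsOver hL.1, Squish.card_isChoice_edges hL.1]
  · rw [Squish.ncard_squish_eq hD,
      Squish.card_isChoice_iUnion (F := fun i => {e | e ∈ (L i).edges}), Nat.cast_prod]
    · refine Finset.prod_congr rfl fun i _ => ?_
      rw [hc (hL i), Squish.card_isChoice_edges (hL i).1]
    · ext e
      rw [Set.mem_iUnion]
      exact ⟨hcov e, fun ⟨i, hi⟩ => (hL i).2 e hi⟩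
    · intro i j hij e he f hf v hv
      exact (hL i).disjoint hD (hL j) (hdisj i j hij) he hf hv
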